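/- A lattice polytope $P\subset\mathbb R^n$ is the convex hull of a non-empty finite subset of $\mathbb Z^n$. Two lattice polytopes (possibly in different ambient spaces) are isomorphic, $P\cong Q$, if an affine isomorphism of their affine hulls maps the lattice points of $\operatorname{aff}(P)$ onto those of $\operatorname{aff}(Q)$ and $P$ onto $Q$. $P$ is a lattice pyramid if it is a single lattice point or $P\cong\operatorname{conv}\bigl((P'\times\{0\})\cup(\{0\}\times\{1\})\bigr)$ for some lattice polytope $P'$. The codegree $\operatorname{codeg}(P)$ is the smallest integer $r\ge1$ such that $rP$ has a lattice point in its relative interior; the degree is $\deg(P)=\dim(P)+1-\operatorname{codeg}(P)$. A lattice polytope $P$ is reflexive if it has a lattice point $x$ in its relative interior from which every facet $F$ has lattice distance one, i.e. some primitive integral affine functional $u$ on $\operatorname{aff}(P)$ (with respect to the lattice points of $\operatorname{aff}(P)$) is constant on $F$ with $u(F)-u(x)=1$. $P$ is Gorenstein if $rP$ is reflexive for some integer $r\ge1$. For lattice polytopes $F,G\subset\mathbb R^n$ let $F*G=\operatorname{conv}\bigl((F\times\{e_1\})\cup(G\times\{e_2\})\bigr)\subset\mathbb R^{n+2}$. A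 Gorenstein polytope $P$ is reducible if it is a single lattice point (by convention) or there are lattice polytopes $F,G\subset\mathbb R^n$, for some $n$, with $P\cong F*G$, $\dim(F)+\dim(G)=\dim(P)-1$ and $\operatorname{codeg}(F)+\operatorname{codeg}(G)=\operatorname{codeg}(P)$. **Proposition.** Suppose that every Gorenstein polytope of dimension $d$ and degree $s$ with $d>2s$ is reducible. Then every Gorenstein polytope of dimension $d$ and degree $s$ with $d\ge 3s$ is a lattice pyramid. -/

import Mathlib

open scoped Pointwise

noncomputable section

namespace LatticePoly

variable {ι κ : Type*}

/-- The lattice `ℤ^ι` inside `ℝ^ι`. -/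
def integerLattice (ι : Type*) : Set (ι → ℝ) :=
  {x | ∀ i, ∃ m : ℤ, x i = (m : ℝ)}

/-- A lattice polytope: the convex hull of a non-empty finite set of lattice points. -/
def IsLatticePolytope (P : Set (ι → ℝ)) : Prop :=
  ∃ V : Finset (ι → ℝ), V.Nonempty ∧ (V : Set (ι → ℝ)) ⊆ integerLattice ι ∧
    P = convexHull ℝ (V : Set (ι → ℝ))

/-- The polytope consists of a single lattice point. -/
def IsSingleLatticePoint (P : Set (ι → ℝ)) : Prop :=
  ∃ z ∈ integerLattice ι, P = {z}

/-- The dimension of the affine hull. -/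
def dim (P : Set (ι → ℝ)) : ℕ :=
  Module.finrank ℝ (vectorSpan ℝ P)

/-- The lattice points of the affine hull of `P`. -/
def affineLattice (P : Set (ι → ℝ)) : Set (ι → ℝ) :=
  (affineSpan ℝ P : Set (ι → ℝ)) ∩ integerLattice ι

/-- Unimodular equivalence, for polytopes that may be lower-dimensional or lie in different ambient
spaces: an affine isomorphism of the affine hulls which maps the lattice points of one affine hull
onto those of the other, and `P` onto `Q`. (An affine map on the affine hull of `P` is written as
the restriction of an affine map of the ambient space; it maps the affine hull of `P` onto that of
`Q` because it maps `P` onto `Q`.) -/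
def LatticeIso (P : Set (ι → ℝ)) (Q : Set (κ → ℝ)) : Prop :=
  ∃ f : (ι → ℝ) →ᵃ[ℝ] (κ → ℝ),
    Set.InjOn f (affineSpan ℝ P : Set (ι → ℝ)) ∧
    f '' affineLattice P = affineLattice Q ∧
    f '' P = Q

/-- The pyramid `conv (P' × {0}, {0} × {1})` of lattice height one over `P'`. -/
def pyramid (P' : Set (ι → ℝ)) : Set (ι ⊕ Fin 1 → ℝ) :=
  convexHull ℝ ((fun x : ι → ℝ => Sum.elim x (0 : Fin 1 → ℝ)) '' P' ∪
    {Sum.elim (0 : ι → ℝ) (1 : Fin 1 → ℝ)})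

/-- Lattice pyramids; a lattice point is a lattice pyramid by convention. -/
def IsLatticePyramid (P : Set (ι → ℝ)) : Prop :=
  IsSingleLatticePoint P ∨
    ∃ (m : ℕ) (P' : Set (Fin m → ℝ)), IsLatticePolytope P' ∧ LatticeIso P (pyramid P')

/-- There is no lattice point in the relative interior. -/
def IsHollow (P : Set (ι → ℝ)) : Prop :=
  ∀ x ∈ intrinsicInterior ℝ P, x ∉ integerLattice ι

/-- The smallest positive integer `r` such that the dilate `rP` is not hollow. -/
def codeg (P : Set (ι → ℝ)) : ℕ :=
  sInf {r : ℕ | 1 ≤ r ∧ ¬ IsHollow ((r : ℝ) • P)}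

/-- The degree `dim P + 1 - codeg P`. -/
def deg (P : Set (ι → ℝ)) : ℤ :=
  (dim P : ℤ) + 1 - (codeg P : ℤ)

/-- Facets: non-empty faces of codimension one. -/
def IsFacet (P F : Set (ι → ℝ)) : Prop :=
  F.Nonempty ∧ IsExposed ℝ P F ∧ dim F + 1 = dim P

/-- `u`, restricted to the affine hull of `P`, is a primitive integral affine functional: it takes
integral values on the lattice points of the affine hull, and its values at some two of these
lattice points differ by one. -/
def IsPrimitiveOn (P : Set (ι → ℝ)) (u : (ι → ℝ) →ᵃ[ℝ] ℝ) : Prop :=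
  (∀ z ∈ affineLattice P, ∃ m : ℤ, u z = (m : ℝ)) ∧
    ∃ z ∈ affineLattice P, ∃ w ∈ affineLattice P, u z - u w = 1

/-- The facet `F` of `P` has lattice distance `k` from the point `x` of the affine hull of `P`. -/
def HasLatticeDistance (P F : Set (ι → ℝ)) (x : ι → ℝ) (k : ℝ) : Prop :=
  ∃ u : (ι → ℝ) →ᵃ[ℝ] ℝ, IsPrimitiveOn P u ∧ ∀ y ∈ F, u y - u x = k

/-- Reflexive polytopes (the interior lattice point need not be the origin). -/
def IsReflexive (P : Set (ι → ℝ)) : Prop :=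
  IsLatticePolytope P ∧
    ∃ x ∈ intrinsicInterior ℝ P, x ∈ integerLattice ι ∧
      ∀ F : Set (ι → ℝ), IsFacet P F → HasLatticeDistance P F x 1

/-- Gorenstein polytopes: some positive integer multiple is reflexive. -/
def IsGorenstein (P : Set (ι → ℝ)) : Prop :=
  IsLatticePolytope P ∧ ∃ r : ℕ, 1 ≤ r ∧ IsReflexive ((r : ℝ) • P)

/-- The Cayley polytope `P₁ * ⋯ * P_l ⊆ ℝ^ι × ℝ^l`, the convex hull of the `P_i × {e_i}`. -/
def cayley {l : ℕ} (P : Fin l → Set (ι → ℝ)) : Set (ι ⊕ Fin l → ℝ) :=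
  convexHull ℝ (⋃ i : Fin l,
    (fun x : ι → ℝ => Sum.elim x (Pi.single i (1 : ℝ) : Fin l → ℝ)) '' P i)

/-- `P` is a Cayley join of the lattice polytopes `F` and `G`. -/
def IsCayleyJoin (P : Set (ι → ℝ)) (F G : Set (κ → ℝ)) : Prop :=
  IsLatticePolytope F ∧ IsLatticePolytope G ∧ LatticeIso P (cayley ![F, G]) ∧
    dim F + dim G + 1 = dim P

/-- The Gorenstein polytope `P` is reducible with factors `F` and `G`. -/
def IsReducibleWithFactors (P : Set (ι → ℝ)) (F G : Set (κ → ℝ)) : Prop :=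
  IsGorenstein P ∧ IsCayleyJoin P F G ∧ codeg F + codeg G = codeg P

/-- Reducible Gorenstein polytopes; a lattice point is reducible by convention. -/
def IsReducible (P : Set (ι → ℝ)) : Prop :=
  IsSingleLatticePoint P ∨
    ∃ (n : ℕ) (F G : Set (Fin n → ℝ)), IsReducibleWithFactors P F G

end LatticePoly

end

/-! The proof is by induction on the dimension `d`. If `d = 0`, the polytope is a lattice point. If
`d > 0`, then `d ≥ 3s` gives `d > 2s`, so by assumption either `P` is a lattice point or `P ≅ F * G`
with `dim F + dim G = d - 1` and `deg F + deg G = s`. If both factors had dimension less than three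
times their degree, then `d - 1 ≤ 3s - 2`, a contradiction. So one factor satisfies the inequality
again. Two facts remain: factors are Gorenstein (`isGorenstein_left`), and a pyramidal factor makes
`P` a pyramid (`isLatticePyramid_of_left`).

Both are proved in the cone over `P`. Reflexivity of `rP` becomes an interior lattice point at
height `r` such that every facet functional takes multiples of its value there
(`IsGorensteinPoint`). Such a point is the only interior lattice point of at most its height
(`eq_of_height_le`): any other one would be cut off by some facet. By additivity of codegrees, the
sum of interior lattice points of the factors at heights `codeg F` and `codeg G` therefore equals
the Gorenstein point of `P` (`exists_join`).

By additivity of dimensions the cone over `P` is a direct sum of those over `F` and `G`, but its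
lattice may be strictly larger than the sum of the two lattices. A facet functional of `F` extends
by zero to a facet functional of `P` with the same value at the Gorenstein point. Hence `F` is
Gorenstein, and the functional exhibiting `F` as a pyramid stays integral on the larger lattice. -/

open scoped Pointwise

noncomputable section

namespace LatticePoly

open Module Submodule

/-! ### Finitely generated cones, their facet functionals and Gorenstein points. -/

section Cone

variable {I J E E' : Type*} [AddCommGroup E] [Module ℝ E] [AddCommGroup E'] [Module ℝ E']

/-- The point `x` has integral distance one from the facets of the cone generated by `v`: every
functional defining a non-trivial facet takes values in the multiples of its value at `x`. -/
def IsGorensteinPoint (Λ : Set E) (v : I → E) (x : E) : Prop :=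
  ∀ u : E →ₗ[ℝ] ℝ, (∀ i, 0 ≤ u (v i)) → (∃ i, u (v i) = 0) →
    finrank ℝ (span ℝ (v '' {i | u (v i) = 0})) + 1 = finrank ℝ (span ℝ (Set.range v)) →
    ∀ z ∈ Λ, z ∈ span ℝ (Set.range v) → ∃ m : ℤ, u z = m * u x

/-- Injectivity on the span preserves the ranks of faces, so facet functionals pull back to facet
functionals. Only lifting of lattice points is needed, since the conclusion tests points of `Λ'`
alone. -/
theorem IsGorensteinPoint.map {Λ : Set E} {v : I → E} {x : E} (h : IsGorensteinPoint Λ v x)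
    (φ : E →ₗ[ℝ] E') {Λ' : Set E'} {v' : I → E'} {x' : E'} (hv : ∀ i, φ (v i) = v' i)
    (hx : φ x = x') (hφ : Set.InjOn φ (span ℝ (Set.range v)))
    (hΛ : ∀ z ∈ Λ', z ∈ span ℝ (Set.range v') → ∃ w ∈ Λ, w ∈ span ℝ (Set.range v) ∧ φ w = z) :
    IsGorensteinPoint Λ' v' x' := by
  intro u hu0 hui hrank z hz hzs
  obtain ⟨w, hw, hws, rfl⟩ := hΛ z hz hzs
  subst hx
  obtain rfl : v' = φ ∘ v := funext fun i => (hv i).symm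
  have key : ∀ s : Set I, finrank ℝ (span ℝ ((φ ∘ v) '' s)) = finrank ℝ (span ℝ (v '' s)) := by
    intro s
    rw [Set.image_comp, ← map_span]
    have hinj : Function.Injective (φ.domRestrict (span ℝ (v '' s))) := by
      intro a b hab
      have hle : span ℝ (v '' s) ≤ span ℝ (Set.range v) := span_mono (Set.image_subset_range _ _)
      exact Subtype.ext (hφ (hle a.2) (hle b.2) hab)
    rw [← LinearMap.range_domRestrict, LinearMap.finrank_range_of_inj hinj]
  refine h (u ∘ₗ φ) hu0 hui ?_ w hw hws
  rw [← Set.image_univ, key, key] at hrank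
  rw [← Set.image_univ, ← hrank]
  rfl

/-- Among the functionals nonnegative on the generators and negative at `z`, one with the most zeros
among the generators defines a facet. Otherwise it could be tilted, keeping its value at `z` and its
zeros, until a further generator becomes a zero. -/
theorem exists_facet_functional [Fintype I] [FiniteDimensional ℝ E] (v : I → E) {z : E}
    (hz : z ∈ span ℝ (Set.range v)) (u₀ : E →ₗ[ℝ] ℝ) (h₀ : ∀ i, 0 ≤ u₀ (v i)) (h₀z : u₀ z < 0) :
    ∃ u : E →ₗ[ℝ] ℝ, (∀ i, 0 ≤ u (v i)) ∧ u z < 0 ∧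
      finrank ℝ (span ℝ (v '' {i | u (v i) = 0})) + 1 = finrank ℝ (span ℝ (Set.range v)) := by
  classical
  let N : (E →ₗ[ℝ] ℝ) → ℕ := fun u => Fintype.card I - (Finset.univ.filter fun i => u (v i) = 0).card
  obtain ⟨u, ⟨hu, huz⟩, hmin⟩ := WellFounded.has_min (measure N).wf
    {u : E →ₗ[ℝ] ℝ | (∀ i, 0 ≤ u (v i)) ∧ u z < 0} ⟨u₀, h₀, h₀z⟩
  refine ⟨u, hu, huz, ?_⟩
  set A := span ℝ (v '' {i | u (v i) = 0}) with hA
  set B := span ℝ (Set.range v) with hB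
  have hAB : A ≤ B := span_mono (Set.image_subset_range _ _)
  have hAu : ∀ a ∈ A, u a = 0 := by
    have : A ≤ LinearMap.ker u := by
      rw [hA, span_le]
      rintro _ ⟨i, hi, rfl⟩
      exact hi
    exact fun a ha => this ha
  have hlt : finrank ℝ A < finrank ℝ B := by
    refine Submodule.finrank_lt_finrank_of_lt (lt_of_le_of_ne hAB ?_)
    intro h
    have := hAu z (h ▸ hz)
    linarith
  by_contra hne
  have hlt' : finrank ℝ A + 1 < finrank ℝ B := by omega
  have hnot : ¬ B ≤ A ⊔ span ℝ {z} := by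
    intro h
    have h1 := Submodule.finrank_mono h
    have h2 := Submodule.finrank_add_le_finrank_add_finrank A (span ℝ {z})
    have h3 := finrank_span_le_card (R := ℝ) ({z} : Set E)
    rw [Set.toFinset_singleton, Finset.card_singleton] at h3
    omega
  obtain ⟨i₀, hi₀⟩ : ∃ i, v i ∉ A ⊔ span ℝ {z} := by
    by_contra! h
    apply hnot
    rw [hB, span_le]
    rintro _ ⟨i, rfl⟩
    exact h i
  obtain ⟨w, hw0, hw⟩ := Submodule.exists_le_ker_of_notMem hi₀
  have hwA : ∀ i, u (v i) = 0 → w (v i) = 0 := fun i hi =>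
    hw (mem_sup_left (subset_span ⟨i, hi, rfl⟩))
  have hwz : w z = 0 := hw (mem_sup_right (mem_span_singleton_self z))
  obtain ⟨w, hwA, hwz, i₁, hi₁⟩ : ∃ w : E →ₗ[ℝ] ℝ, (∀ i, u (v i) = 0 → w (v i) = 0) ∧ w z = 0 ∧
      ∃ i, w (v i) < 0 := by
    rcases lt_or_gt_of_ne hw0 with h | h
    · exact ⟨w, hwA, hwz, i₀, h⟩
    · exact ⟨-w, fun i hi => by simp [hwA i hi], by simp [hwz], i₀, by simpa using h⟩
  obtain ⟨j, hj, hjmin⟩ := Finset.exists_min_image (Finset.univ.filter fun i => w (v i) < 0)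
    (fun i => u (v i) / (-w (v i))) ⟨i₁, by simpa using hi₁⟩
  simp only [Finset.mem_filter, Finset.mem_univ, true_and] at hj hjmin
  -- This is the largest `t` for which `u + t • w` is still nonnegative on the generators; `v j` is
  -- then a new zero.
  set t := u (v j) / (-w (v j)) with ht
  have ht0 : 0 ≤ t := div_nonneg (hu j) (by linarith)
  refine hmin (u + t • w) ⟨fun i => ?_, by simpa [hwz] using huz⟩ ?_
  · simp only [LinearMap.add_apply, LinearMap.smul_apply, smul_eq_mul]
    rcases lt_or_ge (w (v i)) 0 with h | h
    · have := hjmin i h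
      rw [le_div_iff₀ (by linarith)] at this
      linarith
    · have := hu i
      positivity
  · change N _ < N _
    have hss : (Finset.univ.filter fun i => u (v i) = 0) ⊂
        (Finset.univ.filter fun i => (u + t • w) (v i) = 0) := by
      rw [Finset.ssubset_iff_of_subset]
      · refine ⟨j, ?_, ?_⟩
        · simp only [Finset.mem_filter, Finset.mem_univ, true_and, LinearMap.add_apply,
            LinearMap.smul_apply, smul_eq_mul, ht]
          field_simp [hj.ne]
          ring
        · simp only [Finset.mem_filter, Finset.mem_univ, true_and]
          intro h
          have := hwA j h
          linarith
      · intro i hi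
        simp only [Finset.mem_filter, Finset.mem_univ, true_and] at hi ⊢
        simp [hi, hwA i hi]
    have h1 := Finset.card_lt_card hss
    have h2 := Finset.card_le_univ (Finset.univ.filter fun i => (u + t • w) (v i) = 0)
    simp only [N]
    omega

/-- The Gorenstein point is the only positive combination of lattice points of at most its
height. -/
theorem IsGorensteinPoint.eq_of_height_le [Fintype I] [FiniteDimensional ℝ E] {Λ : Set E}
    {v : I → E} {x y : E} (h : IsGorensteinPoint Λ v x) (ht : E →ₗ[ℝ] ℝ) (hv : ∀ i, ht (v i) = 1)
    (hd : 2 ≤ finrank ℝ (span ℝ (Set.range v))) {c b : I → ℝ} (hc : ∀ i, 0 < c i)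
    (hx : ∑ i, c i • v i = x) (hb : ∀ i, 0 < b i) (hy : ∑ i, b i • v i = y) (hyΛ : y ∈ Λ)
    (hle : ht y ≤ ht x) : y = x := by
  by_contra hne
  have hspan : ∀ a : I → ℝ, ∑ i, a i • v i ∈ span ℝ (Set.range v) := fun a =>
    sum_mem fun i _ => smul_mem _ _ (subset_span ⟨i, rfl⟩)
  have hxs : x ∈ span ℝ (Set.range v) := hx ▸ hspan c
  have hys : y ∈ span ℝ (Set.range v) := hy ▸ hspan b
  obtain ⟨g, hg0, -⟩ := Submodule.exists_le_ker_of_notMem (p := (⊥ : Submodule ℝ E)) (v := y - x)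
    (by simpa [sub_eq_zero] using hne)
  obtain ⟨g, hg⟩ : ∃ g : E →ₗ[ℝ] ℝ, g (y - x) < 0 := by
    rcases lt_or_gt_of_ne hg0 with h | h
    · exact ⟨g, h⟩
    · exact ⟨-g, by simpa only [LinearMap.neg_apply, neg_lt_zero] using h⟩
  -- The multiple of the height is large enough to make `K • ht + g` nonnegative on the generators.
  -- As `y - x` has height at most zero, the functional stays negative there.
  set K := 1 + ∑ i, |g (v i)| with hK
  have hKpos : 0 < K := by positivity
  obtain ⟨u, hu, huz, hrank⟩ := exists_facet_functional v (sub_mem hys hxs) (K • ht + g)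
    (fun i => by
      have h1 := Finset.single_le_sum (f := fun i => |g (v i)|) (fun i _ => abs_nonneg _)
        (Finset.mem_univ i)
      have h2 := neg_abs_le (g (v i))
      simp only [LinearMap.add_apply, LinearMap.smul_apply, hv, smul_eq_mul, hK]
      linarith)
    (by
      have : ht (y - x) ≤ 0 := by rw [map_sub]; linarith
      simp only [LinearMap.add_apply, LinearMap.smul_apply, smul_eq_mul]
      nlinarith)
  -- Rank at least two is needed here: the facet `{0}` of a ray contains no generator.
  have hzero : ∃ i, u (v i) = 0 := by
    by_contra! hcon
    have : v '' {i | u (v i) = 0} = ∅ := by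
      rw [Set.image_eq_empty]
      ext i
      simpa using hcon i
    rw [this, span_empty, finrank_bot] at hrank
    omega
  obtain ⟨m, hm⟩ := h u hu hzero hrank y hyΛ hys
  have hpos : ∃ i, 0 < u (v i) := by
    by_contra! hcon
    have h0 : ∀ i, u (v i) = 0 := fun i => le_antisymm (hcon i) (hu i)
    rw [← hy, ← hx] at huz
    simp [h0] at huz
  have hcomb : ∀ a : I → ℝ, (∀ i, 0 < a i) → 0 < u (∑ i, a i • v i) := by
    intro a ha
    obtain ⟨j, hj⟩ := hpos
    rw [map_sum]
    refine Finset.sum_pos' (fun i _ => ?_) ⟨j, Finset.mem_univ _, ?_⟩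
    · rw [map_smul, smul_eq_mul]
      exact mul_nonneg (ha i).le (hu i)
    · rw [map_smul, smul_eq_mul]
      exact mul_pos (ha j) hj
  have hux : 0 < u x := hx ▸ hcomb c hc
  have huy : 0 < u y := hy ▸ hcomb b hb
  -- Both values are positive, so the multiple `m` is at least one and `u y ≥ u x`, against `u (y -
  -- x) < 0`.
  have hm1 : 1 ≤ m := by
    have : (0 : ℝ) < m := by
      by_contra! hcon
      nlinarith
    exact_mod_cast this
  have : (1 : ℝ) ≤ m := by exact_mod_cast hm1
  rw [map_sub] at huz
  nlinarith

theorem exists_extend_zero {A B : Submodule ℝ E} (hAB : Disjoint A B) (u : E →ₗ[ℝ] ℝ) :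
    ∃ w : E →ₗ[ℝ] ℝ, (∀ a ∈ A, w a = u a) ∧ ∀ b ∈ B, w b = 0 := by
  have hinj : Function.Injective (B.mkQ.domRestrict A) := by
    rw [← LinearMap.ker_eq_bot, LinearMap.ker_eq_bot']
    intro a ha
    have : (a : E) ∈ B := by simpa using ha
    exact Subtype.ext (Submodule.disjoint_def.1 hAB a a.2 this)
  obtain ⟨s, hs⟩ := LinearMap.exists_leftInverse_of_injective _ (LinearMap.ker_eq_bot.2 hinj)
  refine ⟨u ∘ₗ A.subtype ∘ₗ s ∘ₗ B.mkQ, fun a ha => ?_, fun b hb => ?_⟩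
  · have := LinearMap.congr_fun hs ⟨a, ha⟩
    simp only [LinearMap.comp_apply, LinearMap.domRestrict_apply, LinearMap.id_apply] at this
    simp only [LinearMap.comp_apply, this, Submodule.subtype_apply]
  · have : B.mkQ b = 0 := by simpa using hb
    simp only [LinearMap.comp_apply, this, map_zero]

/-- A facet functional of one summand of a direct sum of cones extends by zero. -/
theorem IsGorensteinPoint.exists_extension [Nonempty J] [FiniteDimensional ℝ E] {Λ : Set E}
    {v : I → E} {w : J → E} {x y : E} (h : IsGorensteinPoint Λ (Sum.elim v w) (x + y))
    (hdisj : Disjoint (span ℝ (Set.range v)) (span ℝ (Set.range w)))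
    (hx : x ∈ span ℝ (Set.range v)) (hy : y ∈ span ℝ (Set.range w))
    (u : E →ₗ[ℝ] ℝ) (hu : ∀ i, 0 ≤ u (v i))
    (hrank : finrank ℝ (span ℝ (v '' {i | u (v i) = 0})) + 1 = finrank ℝ (span ℝ (Set.range v))) :
    ∃ u' : E →ₗ[ℝ] ℝ, (∀ a ∈ span ℝ (Set.range v), u' a = u a) ∧
      (∀ b ∈ span ℝ (Set.range w), u' b = 0) ∧
      ∀ z ∈ Λ, z ∈ span ℝ (Set.range (Sum.elim v w)) → ∃ m : ℤ, u' z = m * u x := by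
  obtain ⟨u', hA, hB⟩ := exists_extend_zero hdisj u
  have hv : ∀ i, u' (v i) = u (v i) := fun i => hA _ (subset_span ⟨i, rfl⟩)
  have hw : ∀ j, u' (w j) = 0 := fun j => hB _ (subset_span ⟨j, rfl⟩)
  refine ⟨u', hA, hB, fun z hz hzs => ?_⟩
  have hux : u' (x + y) = u x := by rw [map_add, hA x hx, hB y hy, add_zero]
  rw [← hux]
  refine h u' ?_ ?_ ?_ z hz hzs
  · rintro (i | j)
    · simpa [hv] using hu i
    · simp [hw]
  -- The other summand supplies a zero generator, so the facet `{0}` of a one-dimensional first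
  -- summand is covered too.
  · exact ⟨Sum.inr (Classical.arbitrary J), by simp [hw]⟩
  · have h1 : Sum.elim v w '' {i | u' (Sum.elim v w i) = 0} =
        v '' {i | u (v i) = 0} ∪ Set.range w := by
      ext e
      simp [Sum.exists, hv, hw]
    rw [h1, Set.Sum.elim_range, span_union, span_union]
    have e1 := Submodule.finrank_sup_add_finrank_inf_eq (span ℝ (v '' {i | u (v i) = 0}))
      (span ℝ (Set.range w))
    have e2 := Submodule.finrank_sup_add_finrank_inf_eq (span ℝ (Set.range v))
      (span ℝ (Set.range w))
    rw [hdisj.eq_bot, finrank_bot] at e2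
    rw [(hdisj.mono_left (span_mono (Set.image_subset_range _ _))).eq_bot, finrank_bot] at e1
    omega

theorem IsGorensteinPoint.left [Nonempty J] [FiniteDimensional ℝ E] {Λ : Set E}
    {v : I → E} {w : J → E} {x y : E} (h : IsGorensteinPoint Λ (Sum.elim v w) (x + y))
    (hdisj : Disjoint (span ℝ (Set.range v)) (span ℝ (Set.range w)))
    (hx : x ∈ span ℝ (Set.range v)) (hy : y ∈ span ℝ (Set.range w)) :
    IsGorensteinPoint Λ v x := by
  intro u hu _ hrank z hz hzs
  obtain ⟨u', hA, -, hm⟩ := h.exists_extension hdisj hx hy u hu hrank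
  obtain ⟨m, hm⟩ := hm z hz (by
    rw [Set.Sum.elim_range, span_union]
    exact mem_sup_left hzs)
  exact ⟨m, by rw [← hA z hzs, hm]⟩

/-- The functional which exhibits a summand of a direct sum of cones as a pyramid extends. -/
theorem IsGorensteinPoint.exists_apex_functional [Nonempty J] [FiniteDimensional ℝ E]
    {Λ : Set E} {v : I → E} {w : J → E} {x y : E}
    (h : IsGorensteinPoint Λ (Sum.elim v w) (x + y))
    (hdisj : Disjoint (span ℝ (Set.range v)) (span ℝ (Set.range w)))
    (hx : x ∈ span ℝ (Set.range v)) (hy : y ∈ span ℝ (Set.range w))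
    (hxΛ : x ∈ Λ) (i₀ : I) (u : E →ₗ[ℝ] ℝ) (hu₁ : u (v i₀) = 1)
    (hu₀ : ∀ i, i ≠ i₀ → u (v i) = 0)
    (huΛ : ∀ z ∈ Λ, z ∈ span ℝ (Set.range v) → ∃ m : ℤ, u z = m) :
    ∃ u' : E →ₗ[ℝ] ℝ, u' (v i₀) = 1 ∧ (∀ i, i ≠ i₀ → u' (v i) = 0) ∧ (∀ j, u' (w j) = 0) ∧
      ∀ z ∈ Λ, z ∈ span ℝ (Set.range (Sum.elim v w)) → ∃ m : ℤ, u' z = m := by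
  have hset : {i | u (v i) = 0} = {i₀}ᶜ := by
    ext i
    by_cases hi : i = i₀
    · simp [hi, hu₁]
    · simp [hi, hu₀ i hi]
  have hrange : Set.range v = insert (v i₀) (v '' {i₀}ᶜ) := by
    rw [← Set.image_insert_eq, ← Set.image_univ]
    congr 1
    ext i
    simp [em]
  have hker : span ℝ (v '' {i₀}ᶜ) ≤ LinearMap.ker u := by
    rw [span_le]
    rintro _ ⟨i, hi, rfl⟩
    exact hu₀ i hi
  have hrank : finrank ℝ (span ℝ (v '' {i | u (v i) = 0})) + 1 =
      finrank ℝ (span ℝ (Set.range v)) := by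
    rw [hset, hrange, span_insert]
    have e := Submodule.finrank_sup_add_finrank_inf_eq (span ℝ {v i₀}) (span ℝ (v '' {i₀}ᶜ))
    have hd : Disjoint (span ℝ {v i₀}) (span ℝ (v '' {i₀}ᶜ)) := by
      rw [Submodule.disjoint_def]
      intro a ha ha'
      obtain ⟨t, rfl⟩ := mem_span_singleton.1 ha
      have := hker ha'
      simp only [LinearMap.mem_ker, map_smul, hu₁, smul_eq_mul, mul_one] at this
      simp [this]
    have hne : v i₀ ≠ 0 := fun h0 => by simp [h0] at hu₁
    rw [hd.eq_bot, finrank_bot, finrank_span_singleton hne] at e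
    omega
  have hu : ∀ i, 0 ≤ u (v i) := fun i => by
    by_cases hi : i = i₀
    · simp [hi, hu₁]
    · simp [hu₀ i hi]
  obtain ⟨u', hA, hB, hm⟩ := h.exists_extension hdisj hx hy u hu hrank
  have hv : ∀ i, u' (v i) = u (v i) := fun i => hA _ (subset_span ⟨i, rfl⟩)
  -- The extension takes multiples of `u x` on `Λ`, and `u x` is an integer because `x` is itself a
  -- lattice point. This gives integrality without splitting the lattice.
  obtain ⟨k, hk⟩ := huΛ x hxΛ hx
  refine ⟨u', by rw [hv, hu₁], fun i hi => by rw [hv, hu₀ i hi],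
    fun j => hB _ (subset_span ⟨j, rfl⟩), fun z hz hzs => ?_⟩
  obtain ⟨m, hm⟩ := hm z hz hzs
  exact ⟨m * k, by rw [hm, hk]; push_cast; rfl⟩

end Cone

/-! ### Generators placed at height one. -/

section Lift

variable {I E : Type*}

/-- The generators of the cone over the convex hull of the family `v`. -/
def lift (v : I → E) (i : I) : E × ℝ := (v i, 1)

theorem lift_def (v : I → E) (i : I) : lift v i = (v i, 1) := rfl

end Lift

/-! ### Convex hulls, affine spans and dimensions in terms of a generating family. -/

section Family

variable {I E : Type*} [AddCommGroup E] [Module ℝ E]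

theorem smul_convexHull_range (v : I → E) (r : ℝ) :
    r • convexHull ℝ (Set.range v) = convexHull ℝ (Set.range fun i => r • v i) := by
  rw [← convexHull_smul]
  congr 1
  ext x
  simp [Set.mem_smul_set]

theorem finrank_span_prod [FiniteDimensional ℝ E] {S : Set E} (hS : S.Nonempty) {r : ℝ}
    (hr : r ≠ 0) :
    finrank ℝ (span ℝ ((fun p : E => (p, r)) '' S)) = finrank ℝ (vectorSpan ℝ S) + 1 := by
  obtain ⟨p, hp⟩ := hS
  have h1 : span ℝ ((fun p : E => (p, r)) '' S) =
      (vectorSpan ℝ S).map (LinearMap.inl ℝ E ℝ) ⊔ span ℝ {(p, r)} := by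
    apply le_antisymm
    · rw [span_le]
      rintro _ ⟨q, hq, rfl⟩
      have : (q, r) = LinearMap.inl ℝ E ℝ (q - p) + (p, r) := by simp
      simp only [SetLike.mem_coe]
      rw [this]
      exact add_mem (mem_sup_left (mem_map_of_mem (vsub_mem_vectorSpan ℝ hq hp)))
        (mem_sup_right (mem_span_singleton_self _))
    · refine sup_le ?_ ?_
      · rw [vectorSpan_def, map_span, span_le]
        rintro _ ⟨_, ⟨a, ha, b, hb, rfl⟩, rfl⟩
        have : LinearMap.inl ℝ E ℝ (a -ᵥ b) = (a, r) - (b, r) := by simp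
        simp only [SetLike.mem_coe]
        rw [this]
        exact sub_mem (subset_span ⟨a, ha, rfl⟩) (subset_span ⟨b, hb, rfl⟩)
      · rw [span_singleton_le_iff_mem]
        exact subset_span ⟨p, hp, rfl⟩
  have hd : (vectorSpan ℝ S).map (LinearMap.inl ℝ E ℝ) ⊓ span ℝ {(p, r)} = ⊥ := by
    rw [← disjoint_iff, Submodule.disjoint_def]
    rintro _ ⟨a, -, rfl⟩ h
    obtain ⟨t, ht⟩ := mem_span_singleton.1 h
    have h2 := congrArg Prod.snd ht
    simp only [Prod.smul_snd, smul_eq_mul, LinearMap.inl_apply, mul_eq_zero, hr, or_false] at h2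
    rw [← ht, h2, zero_smul]
  have e := Submodule.finrank_sup_add_finrank_inf_eq ((vectorSpan ℝ S).map (LinearMap.inl ℝ E ℝ))
    (span ℝ {(p, r)})
  rw [hd, finrank_bot, add_zero, ← h1,
    (equivMapOfInjective _ LinearMap.inl_injective (vectorSpan ℝ S)).symm.finrank_eq,
    finrank_span_singleton (by simpa [Prod.ext_iff] using fun _ => hr)] at e
  exact e

variable [Fintype I]

theorem mem_convexHull_range (v : I → E) (x : E) :
    x ∈ convexHull ℝ (Set.range v) ↔
      ∃ c : I → ℝ, (∀ i, 0 ≤ c i) ∧ ∑ i, c i = 1 ∧ ∑ i, c i • v i = x := by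
  classical
  have h : convexHull ℝ (Set.range v) = Fintype.linearCombination ℝ v '' stdSimplex ℝ I := by
    rw [← convexHull_basis_eq_stdSimplex, LinearMap.image_convexHull, ← Set.range_comp]
    congr 2
    ext i
    simp [Fintype.linearCombination_apply]
  rw [h]
  constructor
  · rintro ⟨c, ⟨h0, h1⟩, rfl⟩
    exact ⟨c, h0, h1, rfl⟩
  · rintro ⟨c, h0, h1, rfl⟩
    exact ⟨c, ⟨h0, h1⟩, rfl⟩

/-- The predicate `p` serves three cases: nonnegative weights for points of the dilate, positive
ones for its relative interior, arbitrary ones for its affine span. -/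
theorem exists_weights_smul (v : I → E) {r : ℝ} (hr : 0 < r) (p : ℝ → Prop)
    (hp : ∀ a b, 0 < b → p a → p (b * a)) (x : E) :
    (∃ c : I → ℝ, (∀ i, p (c i)) ∧ ∑ i, c i = 1 ∧ ∑ i, c i • r • v i = x) ↔
      ∃ c : I → ℝ, (∀ i, p (c i)) ∧ ∑ i, c i = r ∧ ∑ i, c i • v i = x := by
  constructor
  · rintro ⟨c, h0, h1, rfl⟩
    refine ⟨fun i => r * c i, fun i => hp _ _ hr (h0 i), by rw [← Finset.mul_sum, h1, mul_one], ?_⟩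
    exact Finset.sum_congr rfl fun i _ => by rw [smul_smul, mul_comm]
  · rintro ⟨c, h0, h1, rfl⟩
    refine ⟨fun i => r⁻¹ * c i, fun i => hp _ _ (inv_pos.2 hr) (h0 i), ?_, ?_⟩
    · rw [← Finset.mul_sum, h1, inv_mul_cancel₀ hr.ne']
    · refine Finset.sum_congr rfl fun i _ => ?_
      rw [smul_smul]
      congr 1
      field_simp

theorem mem_smul_convexHull_range (v : I → E) {r : ℝ} (hr : 0 < r) (x : E) :
    x ∈ r • convexHull ℝ (Set.range v) ↔
      ∃ c : I → ℝ, (∀ i, 0 ≤ c i) ∧ ∑ i, c i = r ∧ ∑ i, c i • v i = x := by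
  rw [smul_convexHull_range, mem_convexHull_range]
  exact exists_weights_smul v hr (fun a => 0 ≤ a) (fun a b hb ha => mul_nonneg hb.le ha) x

theorem mem_affineSpan_range (v : I → E) (x : E) :
    x ∈ affineSpan ℝ (Set.range v) ↔ ∃ c : I → ℝ, ∑ i, c i = 1 ∧ ∑ i, c i • v i = x := by
  constructor
  · intro h
    obtain ⟨c, h1, hc⟩ := eq_affineCombination_of_mem_affineSpan_of_fintype h
    refine ⟨c, h1, ?_⟩
    rw [hc, Finset.affineCombination_eq_linear_combination _ _ _ h1]
  · rintro ⟨c, h1, rfl⟩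
    rw [← Finset.affineCombination_eq_linear_combination _ _ _ h1]
    exact affineCombination_mem_affineSpan h1 v

theorem mem_span_lift (v : I → E) (x : E) (t : ℝ) :
    (x, t) ∈ span ℝ (Set.range (lift v)) ↔ ∃ c : I → ℝ, ∑ i, c i = t ∧ ∑ i, c i • v i = x := by
  rw [mem_span_range_iff_exists_fun]
  simp only [lift_def, Prod.ext_iff, Prod.fst_sum, Prod.snd_sum, Prod.smul_fst, Prod.smul_snd,
    smul_eq_mul, mul_one]
  exact exists_congr fun c => and_comm

theorem mem_span_lift_iff_affineSpan (v : I → E) (x : E) {r : ℝ} (hr : 0 < r) :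
    (x, r) ∈ span ℝ (Set.range (lift v)) ↔
      x ∈ affineSpan ℝ (r • convexHull ℝ (Set.range v)) := by
  rw [smul_convexHull_range, affineSpan_convexHull, mem_affineSpan_range, mem_span_lift]
  simpa using (exists_weights_smul v hr (fun _ => True) (fun _ _ _ _ => trivial) x).symm

end Family

/-! ### Relative interiors as strictly positive combinations. -/

section RelativeInterior

variable {E : Type*} [NormedAddCommGroup E] [NormedSpace ℝ E] [FiniteDimensional ℝ E]

/-- The relative interior of a convex set consists of the points from which one can move a little
away from each point of the set. -/
theorem mem_intrinsicInterior_iff_exists_pos {s : Set E} (hs : Convex ℝ s) (x : E) :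
    x ∈ intrinsicInterior ℝ s ↔ x ∈ s ∧ ∀ y ∈ s, ∃ ε > (0 : ℝ), x + ε • (x - y) ∈ s := by
  constructor
  · intro hx
    refine ⟨intrinsicInterior_subset hx, fun y hy => ?_⟩
    obtain ⟨x', hx', rfl⟩ := hx
    have hyA : y ∈ affineSpan ℝ s := subset_affineSpan _ _ hy
    let g : ℝ → affineSpan ℝ s := fun t => ⟨AffineMap.lineMap (x' : E) y (-t),
      AffineMap.lineMap_mem _ x'.2 hyA⟩
    have hg : Continuous g := by
      refine Continuous.subtype_mk ?_ _
      exact AffineMap.lineMap_continuous.comp continuous_neg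
    have hg0 : g 0 = x' := Subtype.ext (by simp [g])
    have hnhds : g ⁻¹' (interior ((↑) ⁻¹' s : Set (affineSpan ℝ s))) ∈ nhds (0 : ℝ) := by
      refine hg.continuousAt.preimage_mem_nhds ?_
      rw [hg0]
      exact isOpen_interior.mem_nhds hx'
    obtain ⟨ε, hε, hball⟩ := Metric.mem_nhds_iff.1 hnhds
    have hmem : (ε / 2) ∈ Metric.ball (0 : ℝ) ε := by
      rw [Metric.mem_ball, dist_zero_right, Real.norm_eq_abs, abs_of_pos (by linarith)]
      linarith
    have h := interior_subset (hball hmem)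
    refine ⟨ε / 2, by linarith, ?_⟩
    have h' : AffineMap.lineMap (x' : E) y (-(ε / 2)) ∈ s := h
    rw [AffineMap.lineMap_apply, vsub_eq_sub, vadd_eq_add] at h'
    convert h' using 1
    module
  · rintro ⟨hx, h⟩
    obtain ⟨y, hy⟩ := Set.Nonempty.intrinsicInterior hs ⟨x, hx⟩
    have hys := intrinsicInterior_subset hy
    obtain ⟨ε, hε, hz⟩ := h y hys
    obtain ⟨y', hy', rfl⟩ := hy
    set z := x + ε • (x - (y' : E)) with hzdef
    have : Nonempty (affineSpan ℝ s) := ⟨y'⟩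
    let z' : affineSpan ℝ s := ⟨z, subset_affineSpan _ _ hz⟩
    -- With this ratio the homothety centred at `z` sends the relative interior point `y'` to `x`,
    -- and carries an open neighbourhood inside `s` along.
    let t : ℝ := ε / (1 + ε)
    have ht0 : 0 < t := by positivity
    have hopen : IsOpenMap (AffineMap.homothety z' t) :=
      AffineMap.homothety_isOpenMap z' t ht0.ne'
    have hsub : AffineMap.homothety z' t '' interior ((↑) ⁻¹' s : Set (affineSpan ℝ s)) ⊆
        (↑) ⁻¹' s := by
      rintro _ ⟨a, ha, rfl⟩
      have has : a ∈ ((↑) ⁻¹' s : Set (affineSpan ℝ s)) := interior_subset ha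
      have : ((AffineMap.homothety z' t a : affineSpan ℝ s) : E) =
          t • (a : E) + (1 - t) • z := by
        simp only [AffineMap.homothety_apply, AffineSubspace.coe_vadd, vadd_eq_add,
          Submodule.coe_smul, AffineSubspace.coe_vsub, vsub_eq_sub, z']
        module
      rw [Set.mem_preimage, this]
      refine hs has hz ht0.le ?_ (by ring)
      have : t ≤ 1 := by
        rw [div_le_one (by positivity)]
        linarith
      linarith
    refine ⟨AffineMap.homothety z' t y', ?_, ?_⟩
    · exact interior_maximal hsub (hopen _ isOpen_interior) ⟨y', hy', rfl⟩
    · simp only [AffineMap.homothety_apply, AffineSubspace.coe_vadd, vadd_eq_add,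
        Submodule.coe_smul, AffineSubspace.coe_vsub, vsub_eq_sub, z', hzdef, t]
      match_scalars <;> field_simp <;> ring

variable {I : Type*} [Fintype I]

theorem mem_intrinsicInterior_convexHull_range (v : I → E) (x : E) :
    x ∈ intrinsicInterior ℝ (convexHull ℝ (Set.range v)) ↔
      ∃ c : I → ℝ, (∀ i, 0 < c i) ∧ ∑ i, c i = 1 ∧ ∑ i, c i • v i = x := by
  rw [mem_intrinsicInterior_iff_exists_pos (convex_convexHull ℝ _)]
  constructor
  · rintro ⟨hx, h⟩
    have hne : Nonempty I := by
      rw [← Set.range_nonempty_iff_nonempty (f := v), ← convexHull_nonempty_iff (𝕜 := ℝ)]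
      exact ⟨x, hx⟩
    have hN : (0 : ℝ) < Fintype.card I := by exact_mod_cast Fintype.card_pos
    let b : ℝ := (Fintype.card I : ℝ)⁻¹
    have hb : 0 < b := inv_pos.2 hN
    have hb1 : ∑ _i : I, b = 1 := by
      rw [Finset.sum_const, Finset.card_univ, nsmul_eq_mul, mul_inv_cancel₀ hN.ne']
    obtain ⟨ε, hε, hz⟩ := h (∑ i, b • v i)
      ((mem_convexHull_range v _).2 ⟨fun _ => b, fun _ => hb.le, hb1, rfl⟩)
    obtain ⟨c, hc0, hc1, hc⟩ := (mem_convexHull_range v _).1 hz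
    have hε1 : 0 < 1 + ε := by linarith
    -- The point `x` is the weighted mean of the point just beyond it and the barycentre, whose
    -- weights are all positive.
    refine ⟨fun i => (1 + ε)⁻¹ * (c i + ε * b), fun i => ?_, ?_, ?_⟩
    · have := hc0 i
      positivity
    · rw [← Finset.mul_sum, Finset.sum_add_distrib, ← Finset.mul_sum, hc1, hb1, mul_one,
        inv_mul_cancel₀ hε1.ne']
    · simp only [mul_smul, ← Finset.smul_sum, add_smul, Finset.sum_add_distrib]
      rw [hc, ← Finset.smul_sum]
      rw [inv_smul_eq_iff₀ hε1.ne']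
      module
  · rintro ⟨c, hc0, hc1, rfl⟩
    refine ⟨(mem_convexHull_range v _).2 ⟨c, fun i => (hc0 i).le, hc1, rfl⟩, fun y hy => ?_⟩
    obtain ⟨b, hb0, hb1, rfl⟩ := (mem_convexHull_range v _).1 hy
    have hne : Nonempty I := by
      by_contra hne
      rw [not_nonempty_iff] at hne
      simp at hc1
    obtain ⟨j, -, hj⟩ := Finset.exists_min_image (Finset.univ : Finset I) c Finset.univ_nonempty
    -- The least weight works as `ε`, since every `b i` is at most one.
    refine ⟨c j, hc0 j, (mem_convexHull_range v _).2
      ⟨fun i => c i + c j * (c i - b i), fun i => ?_, ?_, ?_⟩⟩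
    · have h1 := hj i (Finset.mem_univ i)
      have h2 : b i ≤ 1 := hb1 ▸ Finset.single_le_sum (fun k _ => hb0 k) (Finset.mem_univ i)
      have h3 := hc0 i
      have h4 := hc0 j
      nlinarith
    · rw [Finset.sum_add_distrib, ← Finset.mul_sum, Finset.sum_sub_distrib, hc1, hb1]
      ring
    · simp only [add_smul, mul_smul, sub_smul, Finset.sum_add_distrib, ← Finset.smul_sum,
        Finset.sum_sub_distrib]

theorem mem_intrinsicInterior_smul_convexHull_range (v : I → E) {r : ℝ} (hr : 0 < r) (x : E) :
    x ∈ intrinsicInterior ℝ (r • convexHull ℝ (Set.range v)) ↔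
      ∃ c : I → ℝ, (∀ i, 0 < c i) ∧ ∑ i, c i = r ∧ ∑ i, c i • v i = x := by
  rw [smul_convexHull_range, mem_intrinsicInterior_convexHull_range]
  exact exists_weights_smul v hr (fun a => 0 < a) (fun a b hb ha => mul_pos hb ha) x

end RelativeInterior

/-! ### Faces of a dilate compared with faces of the cone. -/

section Face

variable {I E : Type*} [AddCommGroup E] [Module ℝ E]

theorem sum_smul_lift [Fintype I] (v : I → E) (c : I → ℝ) :
    ∑ i, c i • lift v i = (∑ i, c i • v i, ∑ i, c i) := by
  simp [lift_def, Prod.ext_iff, Prod.fst_sum, Prod.snd_sum]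

theorem smul_lift (v : I → E) (r : ℝ) (i : I) : r • lift v i = (r • v i, r) := by
  simp [lift_def]

/-- A nonnegative combination on which `u` vanishes involves only generators on which `u` vanishes.
This turns codimension one for polytope faces into the rank condition for cone facets. -/
theorem span_face [Fintype I] (v : I → E) {r : ℝ} (hr : 0 < r) (u : E × ℝ →ₗ[ℝ] ℝ)
    (hu : ∀ i, 0 ≤ u (lift v i)) :
    span ℝ ((fun p : E => (p, r)) '' {p ∈ r • convexHull ℝ (Set.range v) | u (p, r) = 0}) =
      span ℝ (lift v '' {i | u (lift v i) = 0}) := by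
  apply le_antisymm
  · rw [span_le]
    rintro _ ⟨p, ⟨hp, hup⟩, rfl⟩
    obtain ⟨c, hc0, hc1, hc⟩ := (mem_smul_convexHull_range v hr p).1 hp
    have hp' : (p, r) = ∑ i, c i • lift v i := by rw [sum_smul_lift, hc, hc1]
    rw [hp', map_sum, Finset.sum_eq_zero_iff_of_nonneg (fun i _ => by
      rw [map_smul, smul_eq_mul]
      exact mul_nonneg (hc0 i) (hu i))] at hup
    simp only [SetLike.mem_coe]
    rw [hp']
    refine sum_mem fun i hi => ?_
    have := hup i hi
    rw [map_smul, smul_eq_mul, mul_eq_zero] at this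
    rcases this with h | h
    · simp [h]
    · exact smul_mem _ _ (subset_span ⟨i, h, rfl⟩)
  · rw [span_le]
    rintro _ ⟨i, hi, rfl⟩
    have hi' : u (lift v i) = 0 := hi
    have h1 : lift v i = r⁻¹ • (r • v i, r) := by
      rw [← smul_lift, smul_smul, inv_mul_cancel₀ hr.ne', one_smul]
    simp only [SetLike.mem_coe]
    rw [h1]
    refine smul_mem _ _ (subset_span ⟨r • v i, ⟨?_, ?_⟩, rfl⟩)
    · exact Set.smul_mem_smul_set (subset_convexHull ℝ _ ⟨i, rfl⟩)
    · rw [← smul_lift, map_smul, hi', smul_zero]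

theorem span_smul_convexHull_range [Fintype I] (v : I → E) {r : ℝ} (hr : 0 < r) :
    span ℝ ((fun p : E => (p, r)) '' (r • convexHull ℝ (Set.range v))) =
      span ℝ (Set.range (lift v)) := by
  simpa using span_face v hr 0 (by simp)

theorem apply_sum_pos [Fintype I] {v : I → E} (u : E →ₗ[ℝ] ℝ) (hu : ∀ i, 0 ≤ u (v i)) {c : I → ℝ}
    (hc : ∀ i, 0 < c i) (hpos : ∃ i, u (v i) ≠ 0) : 0 < u (∑ i, c i • v i) := by
  obtain ⟨j, hj⟩ := hpos
  rw [map_sum]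
  refine Finset.sum_pos' (fun i _ => ?_) ⟨j, Finset.mem_univ _, ?_⟩
  · rw [map_smul, smul_eq_mul]
    exact mul_nonneg (hc i).le (hu i)
  · rw [map_smul, smul_eq_mul]
    exact mul_pos (hc j) (lt_of_le_of_ne (hu j) hj.symm)

theorem exists_apply_ne_zero_of_finrank {v : I → E} (u : E →ₗ[ℝ] ℝ)
    (h : finrank ℝ (span ℝ (v '' {i | u (v i) = 0})) + 1 = finrank ℝ (span ℝ (Set.range v))) :
    ∃ i, u (v i) ≠ 0 := by
  by_contra! hcon
  rw [show {i | u (v i) = 0} = Set.univ from Set.eq_univ_of_forall hcon, Set.image_univ] at h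
  omega

theorem apply_eq_zero_of_codim_one [FiniteDimensional ℝ E] {A B : Submodule ℝ E} (hAB : A ≤ B)
    (hrank : finrank ℝ A + 1 = finrank ℝ B) {x : E} (hxB : x ∈ B) (hxA : x ∉ A) (u : E →ₗ[ℝ] ℝ)
    (huA : ∀ a ∈ A, u a = 0) (hux : u x = 0) {z : E} (hz : z ∈ B) : u z = 0 := by
  have hlt : A < A ⊔ span ℝ {x} :=
    lt_of_le_of_ne le_sup_left fun h => hxA (h ▸ mem_sup_right (mem_span_singleton_self x))
  have h1 := Submodule.finrank_lt_finrank_of_lt hlt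
  have h2 : A ⊔ span ℝ {x} = B := by
    refine Submodule.eq_of_le_of_finrank_le (sup_le hAB ?_) (by omega)
    rwa [span_singleton_le_iff_mem]
  have h3 : A ⊔ span ℝ {x} ≤ LinearMap.ker u := by
    refine sup_le (fun a ha => huA a ha) ?_
    rwa [span_singleton_le_iff_mem]
  rw [h2] at h3
  exact h3 hz

/-- The linear functional which agrees with the affine functional `a` at height `r`. -/
def homogenize (a : E →ᵃ[ℝ] ℝ) (r : ℝ) : E × ℝ →ₗ[ℝ] ℝ :=
  a.linear ∘ₗ LinearMap.fst ℝ E ℝ + (a 0 / r) • LinearMap.snd ℝ E ℝ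

theorem homogenize_apply (a : E →ᵃ[ℝ] ℝ) {r : ℝ} (hr : r ≠ 0) (p : E) :
    homogenize a r (p, r) = a p := by
  have := congrFun (AffineMap.decomp a) p
  rw [this]
  simp [homogenize, hr]

end Face

/-! ### Reflexive dilates correspond to Gorenstein points. -/

section IntegerLattice

variable {ι : Type*}

theorem add_mem_integerLattice {x y : ι → ℝ} (hx : x ∈ integerLattice ι)
    (hy : y ∈ integerLattice ι) : x + y ∈ integerLattice ι := fun i => by
  obtain ⟨a, ha⟩ := hx i
  obtain ⟨b, hb⟩ := hy i
  exact ⟨a + b, by simp [ha, hb]⟩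

theorem smul_mem_integerLattice {x : ι → ℝ} (m : ℤ) (hx : x ∈ integerLattice ι) :
    (m : ℝ) • x ∈ integerLattice ι := fun i => by
  obtain ⟨a, ha⟩ := hx i
  exact ⟨m * a, by simp [ha]⟩

/-- The lattice `ℤ^ι × ℤ`. -/
def homogeneousLattice (ι : Type*) : Set ((ι → ℝ) × ℝ) :=
  {z | z.1 ∈ integerLattice ι ∧ ∃ m : ℤ, z.2 = m}

variable {I : Type*} [Fintype I]

theorem isLatticePolytope_convexHull_range [Nonempty I] (v : I → ι → ℝ)
    (hv : ∀ i, v i ∈ integerLattice ι) : IsLatticePolytope (convexHull ℝ (Set.range v)) := by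
  classical
  refine ⟨Finset.univ.image v, Finset.univ_nonempty.image v, ?_, by simp⟩
  rintro _ hx
  obtain ⟨i, -, rfl⟩ := Finset.mem_image.1 hx
  exact hv i

variable [Fintype ι]

theorem dim_add_one {S : Set (ι → ℝ)} (hS : S.Nonempty) {r : ℝ} (hr : r ≠ 0) :
    dim S + 1 = finrank ℝ (span ℝ ((fun p : ι → ℝ => (p, r)) '' S)) :=
  (finrank_span_prod hS hr).symm

theorem IsReflexive.exists_isGorensteinPoint {v : I → ι → ℝ} (hv : ∀ i, v i ∈ integerLattice ι)
    {r : ℕ} (hr : 1 ≤ r) (h : IsReflexive ((r : ℝ) • convexHull ℝ (Set.range v))) :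
    ∃ x : ι → ℝ, x ∈ integerLattice ι ∧
      (∃ c : I → ℝ, (∀ i, 0 < c i) ∧ ∑ i, c i = r ∧ ∑ i, c i • v i = x) ∧
      IsGorensteinPoint (homogeneousLattice ι) (lift v) (x, (r : ℝ)) := by
  have hr0 : (0 : ℝ) < r := by exact_mod_cast hr
  obtain ⟨-, x, hx, hxl, hfacet⟩ := h
  obtain ⟨c, hc0, hc1, hc⟩ := (mem_intrinsicInterior_smul_convexHull_range v hr0 x).1 hx
  refine ⟨x, hxl, ⟨c, hc0, hc1, hc⟩, ?_⟩
  intro u hu ⟨i₀, hi₀⟩ hrank z hz hzs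
  set P := (r : ℝ) • convexHull ℝ (Set.range v) with hP
  have hX : (x, (r : ℝ)) = ∑ i, c i • lift v i := by rw [sum_smul_lift, hc, hc1]
  have huX : 0 < u (x, (r : ℝ)) := by
    rw [hX]
    exact apply_sum_pos u hu hc0 (exists_apply_ne_zero_of_finrank u hrank)
  have hXs : (x, (r : ℝ)) ∈ span ℝ (Set.range (lift v)) := by
    rw [hX]
    exact sum_mem fun i _ => smul_mem _ _ (subset_span ⟨i, rfl⟩)
  set F := {p ∈ P | u (p, (r : ℝ)) = 0} with hF
  have hvP : ∀ i, (r : ℝ) • v i ∈ P := fun i =>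
    Set.smul_mem_smul_set (subset_convexHull ℝ _ ⟨i, rfl⟩)
  have hy₀ : (r : ℝ) • v i₀ ∈ F := ⟨hvP i₀, by rw [← smul_lift, map_smul, hi₀, smul_zero]⟩
  have hspanF := span_face v hr0 u hu
  have hnonneg : ∀ p ∈ P, 0 ≤ u (p, (r : ℝ)) := by
    intro p hp
    obtain ⟨b, hb0, hb1, hb⟩ := (mem_smul_convexHull_range v hr0 p).1 hp
    rw [← hb, ← hb1, ← sum_smul_lift, map_sum]
    refine Finset.sum_nonneg fun i _ => ?_
    rw [map_smul, smul_eq_mul]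
    exact mul_nonneg (hb0 i) (hu i)
  have hsplit : ∀ p : ι → ℝ, u (p, (r : ℝ)) = u (p, 0) + u (0, (r : ℝ)) := fun p => by
    rw [← map_add]
    simp
  have hFacet : IsFacet P F := by
    refine ⟨⟨_, hy₀⟩, fun _ => ⟨LinearMap.toContinuousLinearMap (-(u ∘ₗ LinearMap.inl ℝ _ ℝ)), ?_⟩,
      ?_⟩
    · ext p
      simp only [hF, Set.mem_ofPred_eq, LinearMap.coe_toContinuousLinearMap', LinearMap.neg_apply,
        LinearMap.comp_apply, LinearMap.inl_apply, neg_le_neg_iff]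
      refine and_congr_right fun hp => ⟨fun h q hq => ?_, fun h => ?_⟩
      · have h1 := hnonneg q hq
        rw [hsplit] at h h1
        linarith
      · refine le_antisymm ?_ (hnonneg p hp)
        have h1 := h _ (hvP i₀)
        have h2 := hy₀.2
        rw [hsplit] at h2 ⊢
        linarith
    · have h1 := dim_add_one (S := F) ⟨_, hy₀⟩ hr0.ne'
      have h2 := dim_add_one (S := P) ⟨_, hvP i₀⟩ hr0.ne'
      rw [hspanF] at h1
      rw [span_smul_convexHull_range v hr0] at h2
      omega
  obtain ⟨a, ⟨haint, -⟩, ha⟩ := hfacet F hFacet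
  set y₀ := (r : ℝ) • v i₀ with hy₀def
  -- The lattice distance to the facet, made linear: it is zero on the facet and one at the interior
  -- point, so `u` equals `u (x, r) • w` on the span by codimension one.
  let w : (ι → ℝ) × ℝ →ₗ[ℝ] ℝ := (a y₀ / r) • LinearMap.snd ℝ _ ℝ - homogenize a r
  have hw : ∀ p : ι → ℝ, w (p, (r : ℝ)) = a y₀ - a p := fun p => by
    simp only [w, LinearMap.sub_apply, LinearMap.smul_apply, LinearMap.snd_apply, smul_eq_mul,
      homogenize_apply a hr0.ne']
    field_simp
  have hwX : w (x, (r : ℝ)) = 1 := by rw [hw, ha y₀ hy₀]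
  have hwF : ∀ q ∈ span ℝ (lift v '' {i | u (lift v i) = 0}), w q = 0 := by
    rw [← hspanF]
    have : span ℝ ((fun p : ι → ℝ => (p, (r : ℝ))) '' F) ≤ LinearMap.ker w := by
      rw [span_le]
      rintro _ ⟨p, hp, rfl⟩
      have h1 := ha p hp
      have h2 := ha y₀ hy₀
      simp only [SetLike.mem_coe, LinearMap.mem_ker, hw]
      linarith
    exact fun q hq => this hq
  have huF : ∀ q ∈ span ℝ (lift v '' {i | u (lift v i) = 0}), u q = 0 := by
    have : span ℝ (lift v '' {i | u (lift v i) = 0}) ≤ LinearMap.ker u := by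
      rw [span_le]
      rintro _ ⟨i, hi, rfl⟩
      exact hi
    exact fun q hq => this hq
  have hprop := apply_eq_zero_of_codim_one (span_mono (Set.image_subset_range _ _)) hrank hXs
    (fun hmem => huX.ne' (huF _ hmem)) (u - u (x, (r : ℝ)) • w)
    (fun q hq => by simp [hwF q hq, huF q hq]) (by simp [hwX]) hzs
  obtain ⟨p, t⟩ := z
  obtain ⟨hp, m, hm⟩ := hz
  simp only at hp hm
  subst hm
  have hmemP : ∀ q ∈ integerLattice ι, (q, (r : ℝ)) ∈ span ℝ (Set.range (lift v)) →
      ∃ k : ℤ, a q = k := fun q hq hqs =>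
    haint q ⟨(mem_span_lift_iff_affineSpan v q hr0).1 hqs, hq⟩
  obtain ⟨k₁, hk₁⟩ := hmemP y₀ (by
      have := smul_mem_integerLattice (r : ℤ) (hv i₀)
      rwa [Int.cast_natCast] at this) (by
    rw [hy₀def, ← smul_lift]
    exact smul_mem _ _ (subset_span ⟨i₀, rfl⟩))
  -- Integrality of `a` is known only at height `r`. A lattice point at height `m` is moved there
  -- along a generator on the facet, which does not change `w`.
  have hshift : (p + ((r - m : ℤ) : ℝ) • v i₀, (r : ℝ)) =
      (p, (m : ℝ)) + ((r - m : ℤ) : ℝ) • lift v i₀ := by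
    simp [lift_def]
  obtain ⟨k₂, hk₂⟩ := hmemP (p + ((r - m : ℤ) : ℝ) • v i₀)
    (add_mem_integerLattice hp (smul_mem_integerLattice _ (hv i₀))) (by
    rw [hshift]
    exact add_mem hzs (smul_mem _ _ (subset_span ⟨i₀, rfl⟩)))
  have hwz : w (p, (m : ℝ)) = a y₀ - a (p + ((r - m : ℤ) : ℝ) • v i₀) := by
    rw [← hw, hshift, map_add, map_smul, hwF _ (subset_span ⟨i₀, hi₀, rfl⟩)]
    simp
  refine ⟨k₁ - k₂, ?_⟩
  simp only [LinearMap.sub_apply, LinearMap.smul_apply, smul_eq_mul, hwz, hk₁, hk₂] at hprop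
  push_cast
  linarith

theorem IsGorensteinPoint.isReflexive {v : I → ι → ℝ} (hv : ∀ i, v i ∈ integerLattice ι)
    {r : ℕ} (hr : 1 ≤ r) {x : ι → ℝ} (hx : x ∈ integerLattice ι) {c : I → ℝ} (hc0 : ∀ i, 0 < c i)
    (hc1 : ∑ i, c i = r) (hc : ∑ i, c i • v i = x)
    (h : IsGorensteinPoint (homogeneousLattice ι) (lift v) (x, (r : ℝ))) :
    IsReflexive ((r : ℝ) • convexHull ℝ (Set.range v)) := by
  have hr0 : (0 : ℝ) < r := by exact_mod_cast hr
  have hne : Nonempty I := by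
    by_contra hne
    rw [not_nonempty_iff] at hne
    simp only [Finset.univ_eq_empty, Finset.sum_empty] at hc1
    linarith
  have hrv : ∀ i, (r : ℝ) • v i ∈ integerLattice ι := fun i => by
    have := smul_mem_integerLattice (r : ℤ) (hv i)
    rwa [Int.cast_natCast] at this
  refine ⟨?_, x, (mem_intrinsicInterior_smul_convexHull_range v hr0 x).2 ⟨c, hc0, hc1, hc⟩, hx, ?_⟩
  · rw [smul_convexHull_range]
    exact isLatticePolytope_convexHull_range _ hrv
  set P := (r : ℝ) • convexHull ℝ (Set.range v) with hP
  have hvP : ∀ i, (r : ℝ) • v i ∈ P := fun i =>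
    Set.smul_mem_smul_set (subset_convexHull ℝ _ ⟨i, rfl⟩)
  rintro F ⟨hFne, hFexp, hFdim⟩
  obtain ⟨l, hFl⟩ := hFexp hFne
  obtain ⟨y₀, hy₀⟩ := hFne
  have hy₀P : y₀ ∈ P := by
    rw [hFl] at hy₀
    exact hy₀.1
  have hmax : ∀ q ∈ P, l q ≤ l y₀ := by
    rw [hFl] at hy₀
    exact hy₀.2
  let u : (ι → ℝ) × ℝ →ₗ[ℝ] ℝ :=
    (l y₀ / r) • LinearMap.snd ℝ _ ℝ - l.toLinearMap ∘ₗ LinearMap.fst ℝ _ ℝ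
  have hu_apply : ∀ p : ι → ℝ, u (p, (r : ℝ)) = l y₀ - l p := fun p => by
    simp only [u, LinearMap.sub_apply, LinearMap.smul_apply, LinearMap.snd_apply, smul_eq_mul,
      LinearMap.comp_apply, LinearMap.fst_apply, ContinuousLinearMap.coe_coe]
    field_simp
  have hu : ∀ i, 0 ≤ u (lift v i) := fun i => by
    have h1 : 0 ≤ u ((r : ℝ) • lift v i) := by
      rw [smul_lift, hu_apply]
      linarith [hmax _ (hvP i)]
    rw [map_smul, smul_eq_mul] at h1
    exact nonneg_of_mul_nonneg_right h1 hr0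
  have hF : F = {p ∈ P | u (p, (r : ℝ)) = 0} := by
    rw [hFl]
    ext p
    simp only [Set.mem_ofPred_eq, hu_apply]
    refine and_congr_right fun hp => ⟨fun h => ?_, fun h q hq => ?_⟩
    · linarith [h y₀ hy₀P, hmax p hp]
    · linarith [hmax q hq]
  have hspanF := span_face v hr0 u hu
  rw [← hP, ← hF] at hspanF
  have hrank : finrank ℝ (span ℝ (lift v '' {i | u (lift v i) = 0})) + 1 =
      finrank ℝ (span ℝ (Set.range (lift v))) := by
    have h1 := dim_add_one (S := F) ⟨_, hy₀⟩ hr0.ne'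
    have h2 := dim_add_one (S := P) ⟨_, hy₀P⟩ hr0.ne'
    rw [hspanF] at h1
    rw [span_smul_convexHull_range v hr0] at h2
    omega
  obtain ⟨i₀, hi₀⟩ : ∃ i, u (lift v i) = 0 := by
    by_contra! hcon
    have hmem : (y₀, (r : ℝ)) ∈ span ℝ ((fun p : ι → ℝ => (p, (r : ℝ))) '' F) :=
      subset_span ⟨y₀, hy₀, rfl⟩
    rw [hspanF] at hmem
    have : lift v '' {i | u (lift v i) = 0} = ∅ := by simp [hcon]
    rw [this, span_empty, mem_bot, Prod.ext_iff] at hmem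
    exact hr0.ne' hmem.2
  have hX : (x, (r : ℝ)) = ∑ i, c i • lift v i := by rw [sum_smul_lift, hc, hc1]
  have huX : 0 < u (x, (r : ℝ)) := by
    rw [hX]
    exact apply_sum_pos u hu hc0 (exists_apply_ne_zero_of_finrank u hrank)
  set d := u (x, (r : ℝ)) with hd
  -- Dividing by `d` and changing sign makes `a` zero on the facet and `-1` at `x`. These two
  -- lattice values also witness primitivity.
  let a : (ι → ℝ) →ᵃ[ℝ] ℝ := d⁻¹ • (l.toLinearMap.toAffineMap - AffineMap.const ℝ _ (l y₀))
  have ha : ∀ p, a p = -(d⁻¹ * u (p, (r : ℝ))) := fun p => by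
    rw [hu_apply]
    simp [a]
    ring
  have hax : a x = -1 := by rw [ha, ← hd, inv_mul_cancel₀ huX.ne']
  have haF : ∀ p ∈ F, a p = 0 := fun p hp => by
    rw [hF] at hp
    rw [ha, hp.2]
    simp
  have hvF : (r : ℝ) • v i₀ ∈ F := by
    rw [hF]
    exact ⟨hvP i₀, by rw [← smul_lift, map_smul, hi₀, smul_zero]⟩
  have hxP : x ∈ P := (mem_smul_convexHull_range v hr0 x).2 ⟨c, fun i => (hc0 i).le, hc1, hc⟩
  refine ⟨a, ⟨fun z hz => ?_, (r : ℝ) • v i₀, ⟨subset_affineSpan _ _ (hvP i₀), hrv i₀⟩, x,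
    ⟨subset_affineSpan _ _ hxP, hx⟩, ?_⟩, fun y hy => ?_⟩
  · obtain ⟨m, hm⟩ := h u hu ⟨i₀, hi₀⟩ hrank (z, (r : ℝ)) ⟨hz.2, r, by simp⟩
      ((mem_span_lift_iff_affineSpan v z hr0).2 hz.1)
    refine ⟨-m, ?_⟩
    rw [ha, hm, ← hd]
    push_cast
    field_simp
  · rw [haF _ hvF, hax]
    ring
  · rw [haF y hy, hax]
    ring

end IntegerLattice

/-! ### Recognizing lattice pyramids by an apex functional. -/

section Pyramid

variable {ι κ J : Type*}

/-- The affine embedding `x ↦ (x, b)`. -/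
def elimRight (b : κ → ℝ) : (ι → ℝ) →ᵃ[ℝ] (ι ⊕ κ → ℝ) where
  toFun x := Sum.elim x b
  linear :=
    { toFun := fun x => Sum.elim x 0
      map_add' := fun x y => by ext (i | i) <;> simp
      map_smul' := fun c x => by ext (i | i) <;> simp }
  map_vadd' x y := by ext (i | i) <;> simp

theorem image_elimRight_convexHull (b : κ → ℝ) (S : Set (ι → ℝ)) :
    (fun x : ι → ℝ => Sum.elim x b) '' convexHull ℝ S =
      convexHull ℝ ((fun x : ι → ℝ => Sum.elim x b) '' S) :=
  AffineMap.image_convexHull (elimRight b) S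

/-- The generators of the pyramid over the convex hull of `w`. -/
def pyramidFamily (w : J → ι → ℝ) : Option J → ι ⊕ Fin 1 → ℝ
  | none => Sum.elim 0 1
  | some j => Sum.elim (w j) 0

theorem pyramid_convexHull_range (w : J → ι → ℝ) :
    pyramid (convexHull ℝ (Set.range w)) = convexHull ℝ (Set.range (pyramidFamily w)) := by
  have h : (fun x : ι → ℝ => Sum.elim x (0 : Fin 1 → ℝ)) '' Set.range w ∪
      {Sum.elim (0 : ι → ℝ) (1 : Fin 1 → ℝ)} = Set.range (pyramidFamily w) := by
    rw [← Set.range_comp]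
    ext x
    simp [pyramidFamily, Option.exists, eq_comm]
  rw [pyramid, image_elimRight_convexHull, convexHull_convexHull_union_left, h]

theorem pyramidFamily_mem_integerLattice {w : J → ι → ℝ} (hw : ∀ j, w j ∈ integerLattice ι)
    (j : Option J) : pyramidFamily w j ∈ integerLattice (ι ⊕ Fin 1) := by
  rcases j with _ | j
  · rintro (i | i)
    · exact ⟨0, by simp [pyramidFamily]⟩
    · exact ⟨1, by simp [pyramidFamily]⟩
  · rintro (i | i)
    · obtain ⟨m, hm⟩ := hw j i
      exact ⟨m, by simp [pyramidFamily, hm]⟩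
    · exact ⟨0, by simp [pyramidFamily]⟩

/-- The affine map `x ↦ (x - a(x) p, a(x))`. -/
def apexMap (a : (ι → ℝ) →ᵃ[ℝ] ℝ) (p : ι → ℝ) : (ι → ℝ) →ᵃ[ℝ] (ι ⊕ Fin 1 → ℝ) where
  toFun x := Sum.elim (x - a x • p) fun _ => a x
  linear :=
    { toFun := fun x => Sum.elim (x - a.linear x • p) fun _ => a.linear x
      map_add' := fun x y => by
        ext (i | i)
        · simp
          ring
        · simp
      map_smul' := fun c x => by
        ext (i | i)
        · simp
          ring
        · simp }
  map_vadd' x y := by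
    have h : a (y + x) = a.linear y + a x := a.map_vadd x y
    ext (i | i)
    · simp [h]
      ring
    · simp [h]

theorem apexMap_apply (a : (ι → ℝ) →ᵃ[ℝ] ℝ) (p x : ι → ℝ) :
    apexMap a p x = Sum.elim (x - a x • p) fun _ => a x := rfl

theorem apexMap_injective (a : (ι → ℝ) →ᵃ[ℝ] ℝ) (p : ι → ℝ) :
    Function.Injective (apexMap a p) := by
  intro x y h
  rw [apexMap_apply, apexMap_apply] at h
  have h1 : a x = a y := congrFun h (Sum.inr 0)
  have h2 : x - a x • p = y - a y • p := funext fun i => congrFun h (Sum.inl i)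
  rw [h1] at h2
  exact sub_left_injective h2

/-- A lattice polytope is a lattice pyramid if some integral affine functional has value one at one
of its generators and vanishes at the others. -/
theorem isLatticePyramid_of_apex {n : ℕ} {I : Type*} [Fintype I] {v : I → Fin n → ℝ}
    (hv : ∀ i, v i ∈ integerLattice (Fin n)) (i₀ : I) (a : (Fin n → ℝ) →ᵃ[ℝ] ℝ)
    (ha₁ : a (v i₀) = 1) (ha₀ : ∀ i, i ≠ i₀ → a (v i) = 0)
    (haint : ∀ z ∈ affineLattice (convexHull ℝ (Set.range v)), ∃ m : ℤ, a z = m) :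
    IsLatticePyramid (convexHull ℝ (Set.range v)) := by
  classical
  by_cases hI : ∀ i, i = i₀
  · left
    refine ⟨v i₀, hv i₀, ?_⟩
    have : Set.range v = {v i₀} := by
      ext x
      constructor
      · rintro ⟨i, rfl⟩
        rw [hI i]
        rfl
      · rintro rfl
        exact ⟨i₀, rfl⟩
    rw [this, convexHull_singleton]
  · right
    push Not at hI
    obtain ⟨i₁, hi₁⟩ := hI
    let w : {i // i ≠ i₀} → Fin n → ℝ := fun i => v i
    have hne : Nonempty {i // i ≠ i₀} := ⟨⟨i₁, hi₁⟩⟩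
    refine ⟨n, convexHull ℝ (Set.range w),
      isLatticePolytope_convexHull_range w fun i => hv i, apexMap a (v i₀), ?_, ?_, ?_⟩
    · exact (apexMap_injective a (v i₀)).injOn
    all_goals
      have himage : apexMap a (v i₀) '' convexHull ℝ (Set.range v) =
          pyramid (convexHull ℝ (Set.range w)) := by
        rw [pyramid_convexHull_range, AffineMap.image_convexHull, ← Set.range_comp]
        congr 1
        have hnone : apexMap a (v i₀) (v i₀) = pyramidFamily w none := by
          rw [apexMap_apply, ha₁]
          ext (i | i) <;> simp [pyramidFamily]
        have hsome : ∀ i : {i // i ≠ i₀}, apexMap a (v i₀) (v i) = pyramidFamily w (some i) := by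
          intro i
          rw [apexMap_apply, ha₀ i i.2]
          ext (k | k) <;> simp [pyramidFamily, w]
        ext x
        constructor
        · rintro ⟨i, rfl⟩
          by_cases hi : i = i₀
          · exact ⟨none, by rw [← hnone, hi]; rfl⟩
          · exact ⟨some ⟨i, hi⟩, by rw [← hsome]; rfl⟩
        · rintro ⟨_ | i, rfl⟩
          · exact ⟨i₀, hnone⟩
          · exact ⟨i, hsome i⟩
    · ext y
      constructor
      · rintro ⟨x, hx, rfl⟩
        refine ⟨?_, ?_⟩
        · rw [← himage, ← AffineSubspace.map_span]
          exact ⟨x, hx.1, rfl⟩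
        · obtain ⟨m, hm⟩ := haint x hx
          rw [apexMap_apply, hm]
          rintro (i | i)
          · obtain ⟨k, hk⟩ := hx.2 i
            obtain ⟨k', hk'⟩ := hv i₀ i
            exact ⟨k - m * k', by simp [hk, hk']⟩
          · exact ⟨m, rfl⟩
      · rintro ⟨hy, hyl⟩
        rw [← himage, ← AffineSubspace.map_span] at hy
        obtain ⟨x, hx, rfl⟩ := hy
        refine ⟨x, ⟨hx, fun i => ?_⟩, rfl⟩
        rw [apexMap_apply] at hyl
        obtain ⟨k, hk⟩ := hyl (Sum.inl i)
        obtain ⟨m, hm⟩ := hyl (Sum.inr 0)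
        obtain ⟨k', hk'⟩ := hv i₀ i
        simp only [Sum.elim_inl, Sum.elim_inr, Pi.sub_apply, Pi.smul_apply, smul_eq_mul] at hk hm
        refine ⟨k + m * k', ?_⟩
        push_cast
        rw [← hk, ← hm, ← hk']
        ring
    · exact himage

end Pyramid

/-! ### Transporting generators and apex functionals along lattice isomorphisms. -/

section Pullback

variable {ι κ J : Type*} {P : Set (ι → ℝ)} {Q : Set (κ → ℝ)}

theorem IsLatticePolytope.convex (h : IsLatticePolytope P) : Convex ℝ P := by
  obtain ⟨V, -, -, rfl⟩ := h
  exact convex_convexHull ℝ _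

theorem IsLatticePolytope.exists_family {ι : Type} {P : Set (ι → ℝ)} (h : IsLatticePolytope P) :
    ∃ (I : Type) (_ : Fintype I) (_ : Nonempty I) (v : I → ι → ℝ),
      (∀ i, v i ∈ integerLattice ι) ∧ P = convexHull ℝ (Set.range v) := by
  obtain ⟨V, hne, hV, rfl⟩ := h
  exact ⟨V, inferInstance, hne.to_subtype, Subtype.val, fun i => hV i.2, by simp⟩

theorem exists_family_of_image_eq (hP : Convex ℝ P) {w : J → κ → ℝ}
    (hw : ∀ j, w j ∈ integerLattice κ) {f : (ι → ℝ) →ᵃ[ℝ] (κ → ℝ)}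
    (hf : Set.InjOn f (affineSpan ℝ P : Set (ι → ℝ)))
    (hfl : f '' affineLattice P = affineLattice (convexHull ℝ (Set.range w)))
    (hfP : f '' P = convexHull ℝ (Set.range w)) :
    ∃ v : J → ι → ℝ, (∀ j, v j ∈ integerLattice ι) ∧ (∀ j, f (v j) = w j) ∧
      P = convexHull ℝ (Set.range v) := by
  have hmem : ∀ j, w j ∈ convexHull ℝ (Set.range w) := fun j => subset_convexHull ℝ _ ⟨j, rfl⟩
  have h1 : ∀ j, ∃ x ∈ P, f x = w j := fun j => by
    have := hmem j
    rw [← hfP] at this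
    exact this
  choose v hvP hv using h1
  have hvs : convexHull ℝ (Set.range v) ⊆ P := by
    refine convexHull_min ?_ hP
    rintro _ ⟨j, rfl⟩
    exact hvP j
  refine ⟨v, fun j => ?_, hv, Set.Subset.antisymm (fun p hp => ?_) hvs⟩
  · have h2 : w j ∈ affineLattice (convexHull ℝ (Set.range w)) :=
      ⟨subset_affineSpan _ _ (hmem j), hw j⟩
    rw [← hfl] at h2
    obtain ⟨z, hz, hzj⟩ := h2
    rw [← hf hz.1 (subset_affineSpan _ _ (hvP j)) (hzj.trans (hv j).symm)]
    exact hz.2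
  · have h2 : f p ∈ f '' convexHull ℝ (Set.range v) := by
      rw [AffineMap.image_convexHull, ← Set.range_comp,
        show f ∘ v = w from funext hv, ← hfP]
      exact ⟨p, hp, rfl⟩
    obtain ⟨q, hq, hqp⟩ := h2
    rw [← hf (subset_affineSpan _ _ (hvs hq)) (subset_affineSpan _ _ hp) hqp]
    exact hq

theorem mem_span_lift_one {I : Type*} [Fintype I] (v : I → ι → ℝ) (x : ι → ℝ) :
    (x, (1 : ℝ)) ∈ span ℝ (Set.range (lift v)) ↔
      x ∈ affineSpan ℝ (convexHull ℝ (Set.range v)) := by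
  rw [mem_span_lift_iff_affineSpan v x one_pos, one_smul]

/-- A lattice pyramid has an integral functional which is one at its apex and zero on its base. -/
theorem IsLatticePyramid.exists_apex {n : ℕ} {F : Set (Fin n → ℝ)} (hF : IsLatticePolytope F)
    (h : IsLatticePyramid F) :
    ∃ (J : Type) (_ : Fintype J) (w : J → Fin n → ℝ) (j₀ : J)
      (u : (Fin n → ℝ) × ℝ →ₗ[ℝ] ℝ), (∀ j, w j ∈ integerLattice (Fin n)) ∧
      F = convexHull ℝ (Set.range w) ∧ u (lift w j₀) = 1 ∧ (∀ j, j ≠ j₀ → u (lift w j) = 0) ∧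
      ∀ z ∈ homogeneousLattice (Fin n), z ∈ span ℝ (Set.range (lift w)) → ∃ m : ℤ, u z = m := by
  rcases h with ⟨z, hz, rfl⟩ | ⟨m, F', hF', f, hf, hfl, hfF⟩
  · refine ⟨Unit, inferInstance, fun _ => z, (), LinearMap.snd ℝ _ ℝ, fun _ => hz, by simp,
      rfl, fun j hj => (hj rfl).elim, fun y hy _ => hy.2⟩
  · obtain ⟨J, _, ⟨j₁⟩, w', hw', rfl⟩ := hF'.exists_family
    rw [pyramid_convexHull_range] at hfl hfF
    obtain ⟨w, hw, hfw, rfl⟩ := exists_family_of_image_eq hF.convex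
      (pyramidFamily_mem_integerLattice hw') hf hfl hfF
    -- The last coordinate of the pyramid, pulled back along the isomorphism.
    let a : (Fin n → ℝ) →ᵃ[ℝ] ℝ :=
      (LinearMap.proj (R := ℝ) (φ := fun _ : Fin m ⊕ Fin 1 => ℝ) (Sum.inr 0)).toAffineMap.comp f
    have ha : ∀ x, a x = f x (Sum.inr 0) := fun x => rfl
    have hu : ∀ x : Fin n → ℝ, homogenize a 1 (x, 1) = a x :=
      fun x => homogenize_apply a one_ne_zero x
    refine ⟨Option J, inferInstance, w, none, homogenize a 1, hw, rfl, ?_, ?_, ?_⟩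
    · rw [lift_def, hu, ha, hfw]
      simp [pyramidFamily]
    · rintro (_ | j) hj
      · exact (hj rfl).elim
      · rw [lift_def, hu, ha, hfw]
        simp [pyramidFamily]
    · rintro ⟨x, t⟩ ⟨hx, k, hk⟩ hs
      simp only at hx hk
      subst hk
      -- Shifting along a base generator reaches height one, where the isomorphism controls lattice
      -- points; the functional vanishes on that generator.
      have hshift : (x + ((1 - k : ℤ) : ℝ) • w (some j₁), (1 : ℝ)) =
          (x, (k : ℝ)) + ((1 - k : ℤ) : ℝ) • lift w (some j₁) := by
        simp [lift_def]
      have hmem : x + ((1 - k : ℤ) : ℝ) • w (some j₁) ∈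
          affineLattice (convexHull ℝ (Set.range w)) := by
        refine ⟨(mem_span_lift_one w _).1 ?_,
          add_mem_integerLattice hx (smul_mem_integerLattice _ (hw _))⟩
        rw [hshift]
        exact add_mem hs (smul_mem _ _ (subset_span ⟨_, rfl⟩))
      have hmem' := Set.mem_image_of_mem f hmem
      rw [hfl] at hmem'
      obtain ⟨k', hk'⟩ := hmem'.2 (Sum.inr 0)
      refine ⟨k', ?_⟩
      rw [← hk', ← ha, ← hu, hshift, map_add, map_smul, lift_def, hu, ha (w _), hfw]
      simp [pyramidFamily]

end Pullback

/-! ### The codegree in terms of positive combinations. -/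

section Codegree

variable {ι I : Type*} [Fintype ι] [Fintype I]

theorem not_isHollow_smul_iff (v : I → ι → ℝ) {r : ℝ} (hr : 0 < r) :
    ¬ IsHollow (r • convexHull ℝ (Set.range v)) ↔
      ∃ x ∈ integerLattice ι, ∃ c : I → ℝ, (∀ i, 0 < c i) ∧ ∑ i, c i = r ∧
        ∑ i, c i • v i = x := by
  simp only [IsHollow, not_forall, not_not, mem_intrinsicInterior_smul_convexHull_range v hr]
  exact ⟨fun ⟨x, hx, hl⟩ => ⟨x, hl, hx⟩, fun ⟨x, hl, hx⟩ => ⟨x, hx, hl⟩⟩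

/-- The sum of all generators is an interior lattice point of a dilate, so the infimum defining the
codegree is attained and is not the default value `0`. -/
theorem codeg_spec [Nonempty I] {v : I → ι → ℝ} (hv : ∀ i, v i ∈ integerLattice ι) :
    1 ≤ codeg (convexHull ℝ (Set.range v)) ∧
      ∃ x ∈ integerLattice ι, ∃ c : I → ℝ, (∀ i, 0 < c i) ∧
        ∑ i, c i = codeg (convexHull ℝ (Set.range v)) ∧ ∑ i, c i • v i = x := by
  have hmem : codeg (convexHull ℝ (Set.range v)) ∈
      {r : ℕ | 1 ≤ r ∧ ¬ IsHollow ((r : ℝ) • convexHull ℝ (Set.range v))} := by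
    refine Nat.sInf_mem ⟨Fintype.card I, Fintype.card_pos, ?_⟩
    rw [not_isHollow_smul_iff v (by exact_mod_cast Fintype.card_pos)]
    refine ⟨∑ i, v i, fun k => ?_, fun _ => 1, fun _ => one_pos, by simp, by simp⟩
    choose m hm using fun i => hv i k
    exact ⟨∑ i, m i, by simp [hm]⟩
  obtain ⟨h1, h2⟩ := hmem
  exact ⟨h1, (not_isHollow_smul_iff v (by exact_mod_cast h1)).1 h2⟩

theorem codeg_le {v : I → ι → ℝ} {r : ℕ} (hr : 1 ≤ r) {x : ι → ℝ} (hx : x ∈ integerLattice ι)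
    {c : I → ℝ} (hc0 : ∀ i, 0 < c i) (hc1 : ∑ i, c i = r) (hc : ∑ i, c i • v i = x) :
    codeg (convexHull ℝ (Set.range v)) ≤ r :=
  Nat.sInf_le ⟨hr, (not_isHollow_smul_iff v (by exact_mod_cast hr)).2 ⟨x, hx, c, hc0, hc1, hc⟩⟩

theorem dim_convexHull_range_add_one [Nonempty I] (v : I → ι → ℝ) :
    dim (convexHull ℝ (Set.range v)) + 1 = finrank ℝ (span ℝ (Set.range (lift v))) := by
  rw [dim_add_one ((Set.range_nonempty v).convexHull) one_ne_zero]
  have := span_smul_convexHull_range v one_pos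
  rw [one_smul] at this
  rw [this]

end Codegree

/-! ### Lattice isomorphisms as linear maps of cones. -/

section Homogenization

variable {ι κ J : Type*}

/-- The linear map which agrees with `f` at height one. -/
def homogenizeMap (f : (ι → ℝ) →ᵃ[ℝ] (κ → ℝ)) : (ι → ℝ) × ℝ →ₗ[ℝ] (κ → ℝ) :=
  f.linear ∘ₗ LinearMap.fst ℝ _ ℝ + (LinearMap.snd ℝ _ ℝ).smulRight (f 0)

theorem homogenizeMap_apply_one (f : (ι → ℝ) →ᵃ[ℝ] (κ → ℝ)) (x : ι → ℝ) :
    homogenizeMap f (x, 1) = f x := by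
  have := congrFun (AffineMap.decomp f) x
  rw [this]
  simp [homogenizeMap]

theorem homogenizeMap_lift (f : (ι → ℝ) →ᵃ[ℝ] (κ → ℝ)) (v : J → ι → ℝ) (j : J) :
    homogenizeMap f (lift v j) = f (v j) := homogenizeMap_apply_one f (v j)

theorem mem_affineSpan_of_height_one [Fintype J] {w : J → κ → ℝ} (ht : (κ → ℝ) →ₗ[ℝ] ℝ)
    (hw : ∀ j, ht (w j) = 1) {y : κ → ℝ} (hy : y ∈ span ℝ (Set.range w)) (hy1 : ht y = 1) :
    y ∈ affineSpan ℝ (convexHull ℝ (Set.range w)) := by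
  rw [affineSpan_convexHull, mem_affineSpan_range]
  obtain ⟨c, rfl⟩ := (mem_span_range_iff_exists_fun ℝ).1 hy
  exact ⟨c, by simpa [hw] using hy1, rfl⟩

variable [Fintype J] {p : J → ι → ℝ} {w : J → κ → ℝ} {f : (ι → ℝ) →ᵃ[ℝ] (κ → ℝ)}

/-- The map preserves heights, so two points with equal images differ by a vector of height zero.
Added to a generator, this vector gives a point at height one, where `f` is injective. -/
theorem injOn_homogenizeMap [Nonempty J] (hfw : ∀ j, f (p j) = w j) (ht : (κ → ℝ) →ₗ[ℝ] ℝ)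
    (hw : ∀ j, ht (w j) = 1)
    (hf : Set.InjOn f (affineSpan ℝ (convexHull ℝ (Set.range p)) : Set (ι → ℝ))) :
    Set.InjOn (homogenizeMap f) (span ℝ (Set.range (lift p))) := by
  obtain ⟨j⟩ := ‹Nonempty J›
  have hheight : ∀ y ∈ span ℝ (Set.range (lift p)), ht (homogenizeMap f y) = y.2 := by
    intro y hy
    obtain ⟨c, rfl⟩ := (mem_span_range_iff_exists_fun ℝ).1 hy
    simp only [map_sum, map_smul, homogenizeMap_lift, hfw, hw, smul_eq_mul, mul_one]
    rw [sum_smul_lift]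
  have hj : lift p j ∈ span ℝ (Set.range (lift p)) := subset_span ⟨j, rfl⟩
  intro y hy z hz hyz
  have hd := sub_mem hy hz
  have h2 : y.2 - z.2 = 0 := by
    rw [← hheight y hy, ← hheight z hz, hyz, sub_self]
  have h3 : (y.1 - z.1 + p j, (1 : ℝ)) = (y - z) + lift p j := by
    simp [Prod.ext_iff, lift_def, h2]
  have h4 : f (y.1 - z.1 + p j) = f (p j) := by
    rw [← homogenizeMap_apply_one f (_ + _), h3, map_add, map_sub, hyz, sub_self, zero_add,
      homogenizeMap_lift]
  have h5 := hf ((mem_span_lift_one p _).1 (by rw [h3]; exact add_mem hd hj))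
    ((mem_span_lift_one p _).1 hj) h4
  refine Prod.ext ?_ (sub_eq_zero.1 h2)
  exact sub_eq_zero.1 (add_eq_right.1 h5)

theorem IsGorensteinPoint.homogenizeMap [Nonempty J] (hfw : ∀ j, f (p j) = w j)
    (hp : ∀ j, p j ∈ integerLattice ι) (hwl : ∀ j, w j ∈ integerLattice κ)
    (ht : (κ → ℝ) →ₗ[ℝ] ℝ) (hw : ∀ j, ht (w j) = 1)
    (htint : ∀ z ∈ integerLattice κ, ∃ m : ℤ, ht z = m)
    (hf : Set.InjOn f (affineSpan ℝ (convexHull ℝ (Set.range p)) : Set (ι → ℝ)))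
    (hfl : affineLattice (convexHull ℝ (Set.range w)) ⊆
      f '' affineLattice (convexHull ℝ (Set.range p)))
    {X : (ι → ℝ) × ℝ} (h : IsGorensteinPoint (homogeneousLattice ι) (lift p) X) :
    IsGorensteinPoint (integerLattice κ) w (LatticePoly.homogenizeMap f X) := by
  refine h.map (LatticePoly.homogenizeMap f) (fun j => by rw [homogenizeMap_lift, hfw]) rfl
    (injOn_homogenizeMap hfw ht hw hf) fun z hz hzs => ?_
  obtain ⟨j⟩ := ‹Nonempty J›
  obtain ⟨m, hm⟩ := htint z hz
  have h1 : z + ((1 - m : ℤ) : ℝ) • w j ∈ affineLattice (convexHull ℝ (Set.range w)) := by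
    refine ⟨mem_affineSpan_of_height_one ht hw
      (add_mem hzs (smul_mem _ _ (subset_span ⟨j, rfl⟩))) ?_,
      add_mem_integerLattice hz (smul_mem_integerLattice _ (hwl j))⟩
    simp [hm, hw]
  obtain ⟨x, ⟨hxs, hxl⟩, hx⟩ := hfl h1
  refine ⟨(x, 1) + ((m - 1 : ℤ) : ℝ) • lift p j, ⟨?_, m, ?_⟩, ?_, ?_⟩
  · exact add_mem_integerLattice hxl (smul_mem_integerLattice _ (hp j))
  · simp [lift_def]
  · exact add_mem ((mem_span_lift_one p x).2 hxs) (smul_mem _ _ (subset_span ⟨j, rfl⟩))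
  · rw [map_add, map_smul, homogenizeMap_apply_one, homogenizeMap_lift, hfw, hx]
    push_cast
    module

end Homogenization

/-! ### Cayley joins and the passage between a reducible polytope and its factors. -/

section Cayley

variable {κ I J : Type*}

/-- The embedding of the cone over a factor into the cone over a Cayley polytope. -/
def cayleyInclusion (e : Fin 2) : (κ → ℝ) × ℝ →ₗ[ℝ] (κ ⊕ Fin 2 → ℝ) where
  toFun y := Sum.elim y.1 (Pi.single e y.2)
  map_add' x y := by ext (i | i) <;> simp [Pi.single_add]
  map_smul' c x := by
    ext (i | i)
    · simp
    · simp [Pi.single_apply]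

theorem cayleyInclusion_apply (e : Fin 2) (y : (κ → ℝ) × ℝ) :
    cayleyInclusion e y = Sum.elim y.1 (Pi.single e y.2) := rfl

/-- The projection of the cone over a Cayley polytope which is left inverse to the inclusion of a
factor. -/
def cayleyProjection (e : Fin 2) : (κ ⊕ Fin 2 → ℝ) →ₗ[ℝ] (κ → ℝ) × ℝ where
  toFun y := (fun i => y (Sum.inl i), y (Sum.inr e))
  map_add' _ _ := rfl
  map_smul' _ _ := rfl

theorem cayleyProjection_inclusion (e : Fin 2) (y : (κ → ℝ) × ℝ) :
    cayleyProjection e (cayleyInclusion e y) = y := by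
  simp [cayleyProjection, cayleyInclusion_apply]

theorem cayleyInclusion_mem_integerLattice (e : Fin 2) {y : (κ → ℝ) × ℝ}
    (hy : y ∈ homogeneousLattice κ) : cayleyInclusion e y ∈ integerLattice (κ ⊕ Fin 2) := by
  rintro (i | i)
  · exact hy.1 i
  · obtain ⟨m, hm⟩ := hy.2
    rw [cayleyInclusion_apply, hm]
    by_cases hi : i = e
    · exact ⟨m, by simp [hi]⟩
    · exact ⟨0, by simp [hi]⟩

theorem span_range_cayleyInclusion (e : Fin 2) (v : I → κ → ℝ) :
    span ℝ (Set.range fun i => cayleyInclusion e (lift v i)) =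
      (span ℝ (Set.range (lift v))).map (cayleyInclusion e) := by
  rw [map_span, ← Set.range_comp]
  rfl

theorem cayleyInclusion_injective (e : Fin 2) :
    Function.Injective (cayleyInclusion (κ := κ) e) :=
  Function.LeftInverse.injective (cayleyProjection_inclusion e)

theorem finrank_span_range_cayleyInclusion (e : Fin 2) (v : I → κ → ℝ) :
    finrank ℝ (span ℝ (Set.range fun i => cayleyInclusion e (lift v i))) =
      finrank ℝ (span ℝ (Set.range (lift v))) := by
  rw [span_range_cayleyInclusion]
  exact (equivMapOfInjective _ (cayleyInclusion_injective e) _).symm.finrank_eq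

/-- The sum of the last two coordinates. -/
def cayleyHeight (κ : Type*) : (κ ⊕ Fin 2 → ℝ) →ₗ[ℝ] ℝ :=
  LinearMap.proj (R := ℝ) (φ := fun _ : κ ⊕ Fin 2 => ℝ) (Sum.inr 0) +
    LinearMap.proj (R := ℝ) (φ := fun _ : κ ⊕ Fin 2 => ℝ) (Sum.inr 1)

theorem cayleyHeight_inclusion (e : Fin 2) (y : (κ → ℝ) × ℝ) :
    cayleyHeight κ (cayleyInclusion e y) = y.2 := by
  fin_cases e <;> simp [cayleyHeight, cayleyInclusion_apply]

theorem cayleyHeight_int {z : κ ⊕ Fin 2 → ℝ} (hz : z ∈ integerLattice (κ ⊕ Fin 2)) :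
    ∃ m : ℤ, cayleyHeight κ z = m := by
  obtain ⟨a, ha⟩ := hz (Sum.inr 0)
  obtain ⟨b, hb⟩ := hz (Sum.inr 1)
  exact ⟨a + b, by simp [cayleyHeight, ha, hb]⟩

/-- The generators of the Cayley polytope of the convex hulls of `v` and `w`. -/
def cayleyFamily (v : I → κ → ℝ) (w : J → κ → ℝ) : I ⊕ J → κ ⊕ Fin 2 → ℝ :=
  Sum.elim (fun i => cayleyInclusion 0 (lift v i)) (fun j => cayleyInclusion 1 (lift w j))

theorem cayley_convexHull_range (v : I → κ → ℝ) (w : J → κ → ℝ) :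
    cayley ![convexHull ℝ (Set.range v), convexHull ℝ (Set.range w)] =
      convexHull ℝ (Set.range (cayleyFamily v w)) := by
  have h : ∀ S : Fin 2 → Set (κ ⊕ Fin 2 → ℝ), ⋃ i, S i = S 0 ∪ S 1 := fun S => by
    ext x
    simp
  rw [cayley, h]
  simp only [Matrix.cons_val_zero, Matrix.cons_val_one]
  rw [image_elimRight_convexHull, image_elimRight_convexHull, convexHull_convexHull_union_left,
    convexHull_convexHull_union_right, ← Set.range_comp, ← Set.range_comp, cayleyFamily,
    Set.Sum.elim_range]
  rfl

theorem cayleyFamily_mem_integerLattice {v : I → κ → ℝ} {w : J → κ → ℝ}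
    (hv : ∀ i, v i ∈ integerLattice κ) (hw : ∀ j, w j ∈ integerLattice κ) (s : I ⊕ J) :
    cayleyFamily v w s ∈ integerLattice (κ ⊕ Fin 2) := by
  rcases s with i | j
  · exact cayleyInclusion_mem_integerLattice 0 ⟨hv i, 1, by simp [lift_def]⟩
  · exact cayleyInclusion_mem_integerLattice 1 ⟨hw j, 1, by simp [lift_def]⟩

theorem cayleyHeight_family (v : I → κ → ℝ) (w : J → κ → ℝ) (s : I ⊕ J) :
    cayleyHeight κ (cayleyFamily v w s) = 1 := by
  rcases s with i | j <;> simp [cayleyFamily, cayleyHeight_inclusion, lift_def]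

theorem sum_smul_cayleyInclusion_lift [Fintype I] (e : Fin 2) {v : I → κ → ℝ} {c : I → ℝ}
    {x : κ → ℝ} {r : ℝ} (hc1 : ∑ i, c i = r) (hc : ∑ i, c i • v i = x) :
    ∑ i, c i • cayleyInclusion e (lift v i) = cayleyInclusion e (x, r) := by
  rw [← hc, ← hc1, ← sum_smul_lift, map_sum]
  simp only [map_smul]

/-- The data of a reducible Gorenstein polytope, in terms of generators of its factors: the
homogenized interior lattice points of the factors add up to the Gorenstein point. -/
theorem IsReducibleWithFactors.exists_join {ι : Type*} [Fintype ι] [Fintype κ] [Fintype I]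
    [Fintype J] [Nonempty I] [Nonempty J] {P : Set (ι → ℝ)} {v : I → κ → ℝ} {w : J → κ → ℝ}
    (h : IsReducibleWithFactors P (convexHull ℝ (Set.range v)) (convexHull ℝ (Set.range w)))
    (hv : ∀ i, v i ∈ integerLattice κ) (hw : ∀ j, w j ∈ integerLattice κ) :
    ∃ (f : (ι → ℝ) →ᵃ[ℝ] (κ ⊕ Fin 2 → ℝ)) (p : I ⊕ J → ι → ℝ) (k : ℕ) (x : κ → ℝ) (c : I → ℝ)
      (y : κ ⊕ Fin 2 → ℝ),
      (∀ s, p s ∈ integerLattice ι) ∧ P = convexHull ℝ (Set.range p) ∧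
      (∀ s, f (p s) = cayleyFamily v w s) ∧
      f '' affineLattice P = affineLattice (convexHull ℝ (Set.range (cayleyFamily v w))) ∧
      Disjoint (span ℝ (Set.range fun i => cayleyInclusion 0 (lift v i)))
        (span ℝ (Set.range fun j => cayleyInclusion 1 (lift w j))) ∧
      1 ≤ k ∧ x ∈ integerLattice κ ∧ (∀ i, 0 < c i) ∧ ∑ i, c i = k ∧ ∑ i, c i • v i = x ∧
      y ∈ span ℝ (Set.range fun j => cayleyInclusion 1 (lift w j)) ∧
      IsGorensteinPoint (integerLattice (κ ⊕ Fin 2)) (cayleyFamily v w)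
        (cayleyInclusion 0 (x, (k : ℝ)) + y) := by
  obtain ⟨⟨hP, r, hr, hrefl⟩, ⟨-, -, ⟨f, hf, hfl, hfP⟩, hdim⟩, hcodeg⟩ := h
  rw [cayley_convexHull_range] at hfl hfP
  obtain ⟨p, hp, hfp, rfl⟩ := exists_family_of_image_eq hP.convex
    (cayleyFamily_mem_integerLattice hv hw) hf hfl hfP
  obtain ⟨x₀, hx₀, ⟨c₀, hc₀0, hc₀1, hc₀⟩, hgor⟩ := hrefl.exists_isGorensteinPoint hp hr
  have hle := codeg_le hr hx₀ hc₀0 hc₀1 hc₀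
  obtain ⟨hk, x, hx, c, hc0, hc1, hc⟩ := codeg_spec hv
  obtain ⟨hl, x', hx', c', hc'0, hc'1, hc'⟩ := codeg_spec hw
  set k := codeg (convexHull ℝ (Set.range v))
  set l := codeg (convexHull ℝ (Set.range w))
  have hxk := sum_smul_cayleyInclusion_lift 0 hc1 hc
  have hxl := sum_smul_cayleyInclusion_lift 1 hc'1 hc'
  have hgor' := hgor.homogenizeMap hfp hp (cayleyFamily_mem_integerLattice hv hw)
    (cayleyHeight κ) (cayleyHeight_family v w) (fun _ hz => cayleyHeight_int hz) hf hfl.superset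
  have hX : ∑ s, c₀ s • cayleyFamily v w s = homogenizeMap f (x₀, (r : ℝ)) := by
    rw [← hc₀1, ← hc₀, ← sum_smul_lift, map_sum]
    simp only [map_smul, homogenizeMap_lift, hfp]
  have hinj := injOn_homogenizeMap hfp (cayleyHeight κ) (cayleyHeight_family v w) hf
  have hrankP : finrank ℝ (span ℝ (Set.range (cayleyFamily v w))) =
      finrank ℝ (span ℝ (Set.range (lift p))) := by
    have h1 : Set.range (cayleyFamily v w) = homogenizeMap f '' Set.range (lift p) := by
      rw [← Set.range_comp]
      congr 1
      funext s
      rw [Function.comp_apply, homogenizeMap_lift, hfp]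
    rw [h1, ← map_span, ← LinearMap.range_domRestrict]
    refine LinearMap.finrank_range_of_inj fun a b hab => Subtype.ext (hinj a.2 b.2 hab)
  have hdP := dim_convexHull_range_add_one p
  have hdv := dim_convexHull_range_add_one v
  have hdw := dim_convexHull_range_add_one w
  have hsup : span ℝ (Set.range (cayleyFamily v w)) =
      span ℝ (Set.range fun i => cayleyInclusion 0 (lift v i)) ⊔
        span ℝ (Set.range fun j => cayleyInclusion 1 (lift w j)) := by
    rw [cayleyFamily, Set.Sum.elim_range, span_union]
  -- The ranks are `dim F + 1`, `dim G + 1` and, for the sum of the spans, `dim P + 1 = (dim F + 1)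
  -- + (dim G + 1)`, which leaves rank zero for the intersection.
  have hdisj : Disjoint (span ℝ (Set.range fun i => cayleyInclusion 0 (lift v i)))
      (span ℝ (Set.range fun j => cayleyInclusion 1 (lift w j))) := by
    have e := Submodule.finrank_sup_add_finrank_inf_eq
      (span ℝ (Set.range fun i => cayleyInclusion 0 (lift v i)))
      (span ℝ (Set.range fun j => cayleyInclusion 1 (lift w j)))
    rw [← hsup, hrankP, finrank_span_range_cayleyInclusion,
      finrank_span_range_cayleyInclusion] at e
    rw [disjoint_iff, ← Submodule.finrank_eq_zero (R := ℝ)]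
    omega
  have hy : ∑ j, c' j • cayleyInclusion 1 (lift w j) ∈
      span ℝ (Set.range fun j => cayleyInclusion 1 (lift w j)) :=
    sum_mem fun j _ => smul_mem _ _ (subset_span ⟨j, rfl⟩)
  rw [hxl] at hy
  refine ⟨f, p, k, x, c, cayleyInclusion 1 (x', (l : ℝ)), hp, rfl, hfp, hfl, hdisj, hk, hx, hc0,
    hc1, hc, hy, ?_⟩
  -- The sum of the two interior points has height `codeg F + codeg G = codeg P ≤ r`, so uniqueness
  -- identifies it with the Gorenstein point. The rank is at least two because `dim P ≥ 1`.
  have heq := hgor'.eq_of_height_le (cayleyHeight κ) (cayleyHeight_family v w)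
    (by rw [hrankP]; omega) hc₀0 hX (b := Sum.elim c c')
    (y := cayleyInclusion 0 (x, (k : ℝ)) + cayleyInclusion 1 (x', (l : ℝ)))
    (by rintro (i | j); exacts [hc0 i, hc'0 j])
    (by rw [Fintype.sum_sum_type, ← hxk, ← hxl]; rfl)
    (add_mem_integerLattice (cayleyInclusion_mem_integerLattice 0 ⟨hx, k, by simp⟩)
      (cayleyInclusion_mem_integerLattice 1 ⟨hx', l, by simp⟩))
    (by
      rw [map_add, cayleyHeight_inclusion, cayleyHeight_inclusion, ← hX, map_sum]
      simp only [map_smul, cayleyHeight_family, smul_eq_mul, mul_one, hc₀1]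
      exact_mod_cast hcodeg.trans_le hle)
  rw [heq]
  exact hgor'

/-- The component of the Gorenstein point in the cone over `F` is again a Gorenstein point, so the
dilate of `F` by `codeg F` is reflexive. -/
theorem IsReducibleWithFactors.isGorenstein_left {ι κ : Type} [Fintype ι] [Fintype κ]
    {P : Set (ι → ℝ)} {F G : Set (κ → ℝ)} (h : IsReducibleWithFactors P F G) :
    IsGorenstein F := by
  have hF := h.2.1.1
  have hG := h.2.1.2.1
  refine ⟨hF, ?_⟩
  obtain ⟨I, _, _, v, hv, rfl⟩ := hF.exists_family
  obtain ⟨J, _, _, w, hw, rfl⟩ := hG.exists_family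
  obtain ⟨f, p, k, x, c, y, -, -, -, -, hdisj, hk, hx, hc0, hc1, hc, hy, hgor⟩ :=
    h.exists_join hv hw
  have hxk := sum_smul_cayleyInclusion_lift 0 hc1 hc
  have hxs : cayleyInclusion 0 (x, (k : ℝ)) ∈
      span ℝ (Set.range fun i => cayleyInclusion 0 (lift v i)) := by
    rw [← hxk]
    exact sum_mem fun i _ => smul_mem _ _ (subset_span ⟨i, rfl⟩)
  refine ⟨k, hk, (IsGorensteinPoint.map (hgor.left hdisj hxs hy) (cayleyProjection 0)
    (fun i => cayleyProjection_inclusion 0 _) (cayleyProjection_inclusion 0 _) ?_ ?_).isReflexive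
    hv hk hx hc0 hc1 hc⟩
  · rw [span_range_cayleyInclusion]
    rintro _ ⟨a, -, rfl⟩ _ ⟨b, -, rfl⟩ hab
    rw [cayleyProjection_inclusion, cayleyProjection_inclusion] at hab
    rw [hab]
  · intro z hz hzs
    refine ⟨cayleyInclusion 0 z, cayleyInclusion_mem_integerLattice 0 hz, ?_,
      cayleyProjection_inclusion 0 z⟩
    rw [span_range_cayleyInclusion]
    exact mem_map_of_mem hzs

theorem IsReducibleWithFactors.isLatticePyramid_of_left {n m : ℕ} {P : Set (Fin n → ℝ)}
    {F G : Set (Fin m → ℝ)} (h : IsReducibleWithFactors P F G) (hpyr : IsLatticePyramid F) :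
    IsLatticePyramid P := by
  obtain ⟨I, _, v, i₀, u, hv, rfl, hu₁, hu₀, huint⟩ := hpyr.exists_apex h.2.1.1
  obtain ⟨J, _, _, w, hw, rfl⟩ := h.2.1.2.1.exists_family
  have hI : Nonempty I := ⟨i₀⟩
  obtain ⟨f, p, k, x, c, y, hp, rfl, hfp, hfl, hdisj, hk, hx, hc0, hc1, hc, hy, hgor⟩ :=
    h.exists_join hv hw
  have hxk := sum_smul_cayleyInclusion_lift 0 hc1 hc
  have hxs : cayleyInclusion 0 (x, (k : ℝ)) ∈
      span ℝ (Set.range fun i => cayleyInclusion 0 (lift v i)) := by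
    rw [← hxk]
    exact sum_mem fun i _ => smul_mem _ _ (subset_span ⟨i, rfl⟩)
  obtain ⟨u', hu'₁, hu'₀, hu'w, hu'int⟩ := hgor.exists_apex_functional hdisj hxs hy
    (cayleyInclusion_mem_integerLattice 0 ⟨hx, k, by simp⟩) i₀ (u ∘ₗ cayleyProjection 0)
    (by simpa [cayleyProjection_inclusion] using hu₁)
    (fun i hi => by simpa [cayleyProjection_inclusion] using hu₀ i hi)
    (fun z hz hzs => by
      rw [span_range_cayleyInclusion] at hzs
      obtain ⟨b, hb, rfl⟩ := hzs
      simp only [LinearMap.comp_apply, cayleyProjection_inclusion]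
      refine huint b ⟨fun i => hz (Sum.inl i), ?_⟩ hb
      obtain ⟨m, hm⟩ := hz (Sum.inr 0)
      exact ⟨m, by simpa [cayleyInclusion_apply] using hm⟩)
  refine isLatticePyramid_of_apex hp (Sum.inl i₀) (u'.toAffineMap.comp f) ?_ ?_ ?_
  · simpa [hfp, cayleyFamily] using hu'₁
  · rintro (i | j) hs
    · simpa [hfp, cayleyFamily] using hu'₀ i fun hi => hs (by rw [hi])
    · simpa [hfp, cayleyFamily] using hu'w j
  · intro z hz
    have hfz := Set.mem_image_of_mem f hz
    rw [hfl] at hfz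
    refine hu'int (f z) hfz.2 ?_
    have h1 := hfz.1
    rw [affineSpan_convexHull] at h1
    exact affineSpan_subset_span h1

end Cayley

/-! ### Symmetry of the join in its two factors. -/

section Swap

variable {ι κ : Type*}

/-- The exchange of the last two coordinates. -/
def cayleySwap (κ : Type*) : (κ ⊕ Fin 2 → ℝ) →ₗ[ℝ] (κ ⊕ Fin 2 → ℝ) :=
  LinearMap.funLeft ℝ ℝ (Sum.map id (Equiv.swap 0 1))

theorem cayleySwap_swap (y : κ ⊕ Fin 2 → ℝ) : cayleySwap κ (cayleySwap κ y) = y := by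
  ext (i | i) <;> simp [cayleySwap, LinearMap.funLeft_apply]

theorem cayleySwap_mem_integerLattice {y : κ ⊕ Fin 2 → ℝ}
    (hy : y ∈ integerLattice (κ ⊕ Fin 2)) : cayleySwap κ y ∈ integerLattice (κ ⊕ Fin 2) :=
  fun _ => hy _

theorem image_cayleySwap_cayley (F G : Set (κ → ℝ)) :
    cayleySwap κ '' cayley ![F, G] = cayley ![G, F] := by
  have h : ∀ S : Fin 2 → Set (κ ⊕ Fin 2 → ℝ), ⋃ i, S i = S 0 ∪ S 1 := fun S => by
    ext x
    simp
  have h0 : ∀ x : κ → ℝ, cayleySwap κ (Sum.elim x (Pi.single 0 1)) = Sum.elim x (Pi.single 1 1) :=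
    fun x => by
      ext (i | i)
      · simp [cayleySwap, LinearMap.funLeft_apply]
      · fin_cases i <;> simp [cayleySwap, LinearMap.funLeft_apply]
  have h1 : ∀ x : κ → ℝ, cayleySwap κ (Sum.elim x (Pi.single 1 1)) = Sum.elim x (Pi.single 0 1) :=
    fun x => by rw [← h0, cayleySwap_swap]
  rw [cayley, cayley, LinearMap.image_convexHull, h, h, Set.image_union, Set.union_comm]
  simp only [Matrix.cons_val_zero, Matrix.cons_val_one, Set.image_image, h0, h1]

theorem IsReducibleWithFactors.swap {P : Set (ι → ℝ)} {F G : Set (κ → ℝ)}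
    (h : IsReducibleWithFactors P F G) : IsReducibleWithFactors P G F := by
  obtain ⟨hP, ⟨hF, hG, ⟨f, hf, hfl, hfP⟩, hdim⟩, hcodeg⟩ := h
  have hinj : Function.Injective (cayleySwap κ) :=
    Function.LeftInverse.injective cayleySwap_swap
  refine ⟨hP, ⟨hG, hF, ⟨(cayleySwap κ).toAffineMap.comp f, ?_, ?_, ?_⟩, by omega⟩, by omega⟩
  · exact hinj.comp_injOn hf
  · rw [AffineMap.coe_comp, Set.image_comp, hfl, LinearMap.coe_toAffineMap, affineLattice,
      affineLattice, Set.image_inter hinj, ← image_cayleySwap_cayley F G]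
    congr 1
    · have := AffineSubspace.map_span (k := ℝ) (cayleySwap κ).toAffineMap (cayley ![F, G])
      rw [LinearMap.coe_toAffineMap] at this
      rw [← this]
      rfl
    · ext y
      exact ⟨fun ⟨z, hz, hzy⟩ => hzy ▸ cayleySwap_mem_integerLattice hz,
        fun hy => ⟨_, cayleySwap_mem_integerLattice hy, cayleySwap_swap y⟩⟩
  · rw [AffineMap.coe_comp, Set.image_comp, hfP, LinearMap.coe_toAffineMap,
      image_cayleySwap_cayley]

end Swap

/-! ### The induction on the dimension. -/

theorem IsLatticePolytope.isSingleLatticePoint_of_dim_eq_zero {ι : Type*} [Fintype ι]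
    {P : Set (ι → ℝ)} (hP : IsLatticePolytope P) (h : dim P = 0) : IsSingleLatticePoint P := by
  obtain ⟨V, ⟨z, hz⟩, hV, rfl⟩ := hP
  refine ⟨z, hV hz, ?_⟩
  rw [dim, Submodule.finrank_eq_zero, vectorSpan_eq_bot_iff_subsingleton] at h
  exact h.eq_singleton_of_mem (subset_convexHull ℝ _ hz)

theorem IsReducibleWithFactors.deg_add_deg {ι κ : Type*} {P : Set (ι → ℝ)} {F G : Set (κ → ℝ)}
    (h : IsReducibleWithFactors P F G) : deg F + deg G = deg P := by
  have h1 := h.2.1.2.2.2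
  have h2 := h.2.2
  simp only [deg]
  omega

end LatticePoly

end

theorem mainTheorem5
    (refined_conjecture : ∀ (n : ℕ) (P : Set (Fin n → ℝ)), LatticePoly.IsGorenstein P →
      (LatticePoly.dim P : ℤ) > 2 * LatticePoly.deg P → LatticePoly.IsReducible P) :
    ∀ (n : ℕ) (P : Set (Fin n → ℝ)), LatticePoly.IsGorenstein P →
      (LatticePoly.dim P : ℤ) ≥ 3 * LatticePoly.deg P → LatticePoly.IsLatticePyramid P := by
  suffices H : ∀ (d n : ℕ) (P : Set (Fin n → ℝ)), LatticePoly.dim P = d →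
      LatticePoly.IsGorenstein P → (LatticePoly.dim P : ℤ) ≥ 3 * LatticePoly.deg P →
      LatticePoly.IsLatticePyramid P from fun n P => H _ n P rfl
  intro d
  induction d using Nat.strong_induction_on with
  | _ d ih =>
    intro n P hd hP hdeg
    by_cases hd0 : LatticePoly.dim P = 0
    · exact Or.inl (hP.1.isSingleLatticePoint_of_dim_eq_zero hd0)
    -- Positive dimension matters here: for degree at most zero, `d > 2s` follows from `d > 0`
    -- alone.
    rcases refined_conjecture n P hP (by omega) with hpt | ⟨m, F, G, h⟩
    · exact Or.inl hpt
    have hdim := h.2.1.2.2.2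
    have hsum := h.deg_add_deg
    by_cases hF : (LatticePoly.dim F : ℤ) ≥ 3 * LatticePoly.deg F
    · exact h.isLatticePyramid_of_left (ih _ (by omega) m F rfl h.isGorenstein_left hF)
    -- If `dim F ≤ 3 deg F - 1`, then `dim G = d - 1 - dim F ≥ 3s - 3 deg F = 3 deg G`.
    · exact h.swap.isLatticePyramid_of_left
        (ih _ (by omega) m G rfl h.swap.isGorenstein_left (by omega))
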